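/- Let $l,\lambda,\mu,\omega\in\mathbb C$ with $\mu,\omega\neq0$ and $\lambda+\mu^2=\frac1{4\omega^2}$. Consider the double confluent Heun equation $$z^2E''+\bigl((l+1)z+\mu(1-z^2)\bigr)E'+\bigl(\lambda-\mu(l+1)z\bigr)E=0 \qquad(\ast)$$ on $\mathbb C^*=\mathbb C\setminus\{0\}$. Its monodromy operator acts on the two-dimensional space of germs of holomorphic solutions at a point $z_0\in\mathbb C^*$ by analytic extension along the counterclockwise circuit $t\mapsto z_0e^{2\pi it}$, $t\in[0,1]$, around zero (its eigenvalues do not depend on $z_0$). For $s\in\mathbb C$ with $s^2\neq\frac{l^2}4$ set $$M(s)=\begin{pmatrix}1+\dfrac{\lambda}{s^2-\frac{l^2}4}&\dfrac{\mu^2}{s^2-\frac{l^2}4}\\ 1&0\end{pmatrix}.$$ 1. Let $l\notin2\mathbb Z$ and put $M_k=M(k)$ for $k\in\mathbb Z$. For every $k\in\mathbb Z$ the infinite product $R_k=M_kM_{k+1}M_{k+2}\cdots$ converges; denote by $R_{k,ij}$ the entries of its limit. The monodromy operator of $(\ast)$ has eigenvalue $e^{-\pi il}$ if and only if, for at least one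 choice of the sign, $$R_{0,21}\pm\omega l\,(R_{0,21}-R_{0,11})=0 .$$ 2. Let $l\notin2\mathbb Z+1$ and put $M_k=M(k-\frac12)$ for $k\in\mathbb Z$. For every $k\in\mathbb Z$ the infinite product $R_k=M_kM_{k+1}M_{k+2}\cdots$ converges; denote by $R_{k,ij}$ the entries of its limit. The monodromy operator of $(\ast)$ has eigenvalue $-e^{-\pi il}$ if and only if, for at least one choice of the sign, $$R_{1,11}\pm2\omega\mu\,(R_{1,11}-R_{1,21})=0 .$$ -/

import Mathlib

open Filter Topology

noncomputable section

/-- The double confluent Heun operator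
`𝓛 E = z² E'' + (n z + μ (1 - z²)) E' + (lam - μ n z) E`, evaluated at the point `z`. -/
def heunOperator (n lam μ : ℂ) (E : ℂ → ℂ) (z : ℂ) : ℂ :=
  z ^ 2 * deriv (deriv E) z + (n * z + μ * (1 - z ^ 2)) * deriv E z + (lam - μ * n * z) * E z

/-- The germ of `E` at `z₀` is a (holomorphic) germ of solution of the Heun equation `𝓛 E = 0`. -/
def IsHeunSolutionGerm (n lam μ z₀ : ℂ) (E : ℂ → ℂ) : Prop :=
  AnalyticAt ℂ E z₀ ∧ ∀ᶠ z in 𝓝 z₀, heunOperator n lam μ E z = 0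

/-- The germ of `G` at `γ 1` is the result of the analytic extension of the germ of `E` at `γ 0`
along the path `γ : [0, 1] → ℂ`: there is a family of analytic germs `F t` at the points `γ t`
that starts at `E`, ends at `G`, and in which the germs with parameters near `t` are all
represented by the one function `F t`. -/
def IsAnalyticContinuation (γ : ℝ → ℂ) (E G : ℂ → ℂ) : Prop :=
  ∃ F : ℝ → ℂ → ℂ,
    (∀ t ∈ Set.Icc (0 : ℝ) 1, AnalyticAt ℂ (F t) (γ t)) ∧
    (∀ t ∈ Set.Icc (0 : ℝ) 1, ∀ᶠ u in 𝓝[Set.Icc (0 : ℝ) 1] t, F u =ᶠ[𝓝 (γ u)] F t) ∧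
    F 0 =ᶠ[𝓝 (γ 0)] E ∧ F 1 =ᶠ[𝓝 (γ 1)] G

/-- The counterclockwise circuit around zero that starts (and ends) at `z₀`. -/
def circuit (z₀ : ℂ) (t : ℝ) : ℂ :=
  z₀ * Complex.exp (2 * (Real.pi : ℂ) * Complex.I * (t : ℂ))

/-- `c` is an eigenvalue of the monodromy operator of the Heun equation, which acts on the germs of
solutions at the nonsingular point `z₀` by analytic extension along the counterclockwise circuit
around zero: there is a germ of solution, not identically zero, that is sent to `c` times itself. -/
def IsHeunMonodromyEigenvalue (n lam μ z₀ c : ℂ) : Prop :=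
  ∃ E : ℂ → ℂ, IsHeunSolutionGerm n lam μ z₀ E ∧ ¬ (E =ᶠ[𝓝 z₀] 0) ∧
    IsAnalyticContinuation (circuit z₀) E (fun z => c * E z)

/-- The matrix with rows `(1 + lam / (s² - l²/4), μ² / (s² - l²/4))` and `(1, 0)`. -/
def heunMatrix (l lam μ s : ℂ) : Matrix (Fin 2) (Fin 2) ℂ :=
  !![1 + lam / (s ^ 2 - l ^ 2 / 4), μ ^ 2 / (s ^ 2 - l ^ 2 / 4); 1, 0]

/-- The finite product `M k * M (k + 1) * ⋯ * M (k + N - 1)`, in this order. -/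
def partialProd (M : ℤ → Matrix (Fin 2) (Fin 2) ℂ) (k : ℤ) (N : ℕ) : Matrix (Fin 2) (Fin 2) ℂ :=
  ((List.range N).map fun j => M (k + (j : ℤ))).prod

/-- The infinite product `M k * M (k + 1) * M (k + 2) * ⋯` converges to the matrix `P`. -/
def HasInfiniteProd (M : ℤ → Matrix (Fin 2) (Fin 2) ℂ) (k : ℤ) (P : Matrix (Fin 2) (Fin 2) ℂ) :
    Prop :=
  Tendsto (partialProd M k) atTop (𝓝 P)

end

/-! A solution with multiplier `exp (2πi b)`, where `b = -l/2 - δ`, has the form `z^b` times a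
Laurent series on all of `ℂ*`. Its coefficients satisfy a three-term recurrence. The cases `δ = 0`
and `δ = 1/2` give the multipliers `e^{-πil}` and `-e^{-πil}`. The question is therefore when the
recurrence has a nonzero solution that is small at both `+∞` and `-∞`.

At `+∞`, rescaling by `c k = μ^k / Γ(k - δ - l/2 + 1)` turns the recurrence into the matrix
recursion `R k = M k * R (k + 1)`. So `u k = c k * R k 1 0` is a solution that decays faster than
any exponential. The Casoratian shows that every solution of at most exponential growth at `+∞` is a
multiple of `u` (`exists_eq_const_mul_recessive`).

Decay at `-∞` is replaced by a symmetry. The map `E ↦ 2ω z^{-l-1} (E'(1/z) - μ E(1/z))` swaps `0`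
and `∞`, preserves the equation, squares to the identity on solutions since `λ + μ² = 1/(4ω²)`, and
preserves the exponents since `2δ` is an integer. If a two-sided solution exists, then `u` and its
image are proportional, with factor `ε = ±1` (`exists_involution_eq`). Conversely, if `u` is fixed
up to sign, its decay at `+∞` carries over to `-∞` (`summable_of_involution_eq`). By `involution_eq`
it suffices to test this at one central index, and there it is the stated equation in the entries of
`R`.

Solutions and coefficients are linked in one direction by continuing the series in `t = log z`, and
in the other by taking Fourier coefficients of the continued germ along the circuit. -/

noncomputable section

/-! ### The recurrence, its symmetry and its Casoratian -/

/-- The three-term recurrence satisfied by the coefficients of a solution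
`∑ a k * z ^ (k - δ - l / 2)` of the Heun equation. -/
def IsHeunCoeff (l lam μ δ : ℂ) (a : ℤ → ℂ) : Prop :=
  ∀ k : ℤ, (((k : ℂ) - δ) ^ 2 - l ^ 2 / 4 + lam) * a k + μ * ((k : ℂ) - δ + 1 - l / 2) * a (k + 1)
    - μ * ((k : ℂ) - δ + l / 2) * a (k - 1) = 0

/-- The action on coefficients of the symmetry
`E ↦ 2 ω z ^ (-l - 1) (E' (1 / z) - μ E (1 / z))` of the Heun equation. -/
def heunInvolution (l μ ω δ : ℂ) (p : ℤ) (a : ℤ → ℂ) (k : ℤ) : ℂ :=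
  2 * ω * ((-((k : ℂ) - δ) - l / 2) * a (p - k) - μ * a (p - k - 1))

/-- The discrete Wronskian of two sequences. -/
def casoratian (u a : ℤ → ℂ) (k : ℤ) : ℂ := u (k - 1) * a k - u k * a (k - 1)

namespace IsHeunCoeff

variable {l lam μ ω δ : ℂ} {p : ℤ} {a u : ℤ → ℂ}

theorem sub_const_mul (ha : IsHeunCoeff l lam μ δ a) (hu : IsHeunCoeff l lam μ δ u) (x : ℂ) :
    IsHeunCoeff l lam μ δ (fun k => a k - x * u k) := by
  intro k
  linear_combination ha k - x * hu k

/-- The recurrence for the image at `k` is a combination of the recurrences for `a` at `p - k` and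
`p - k - 1`. The condition `p = 2δ` makes the reflection send exponents to exponents. -/
theorem involution (ha : IsHeunCoeff l lam μ δ a) (hp : (p : ℂ) = 2 * δ) :
    IsHeunCoeff l lam μ δ (heunInvolution l μ ω δ p a) := by
  intro k
  have h1 := ha (p - k)
  have h2 := ha (p - k - 1)
  simp only [heunInvolution]
  have e1 : p - (k + 1) = p - k - 1 := by ring
  have e2 : p - (k - 1) = p - k + 1 := by ring
  have e3 : p - k + 1 - 1 = p - k := by ring
  have e4 : p - k - 1 + 1 = p - k := by ring
  rw [e1, e2, e3]
  rw [e4] at h2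
  push_cast at h1 h2 ⊢
  rw [hp] at h1 h2
  linear_combination (-2 * ω * ((k : ℂ) - δ + l / 2)) * h1 - 2 * ω * μ * h2

/-- Modulo the recurrence at `k`, the double image is `4ω²(λ + μ²) a k`. This is where the relation
between the parameters enters. -/
theorem involution_involution (ha : IsHeunCoeff l lam μ δ a) (hp : (p : ℂ) = 2 * δ) (hω : ω ≠ 0)
    (hparam : lam + μ ^ 2 = 1 / (4 * ω ^ 2)) (k : ℤ) :
    heunInvolution l μ ω δ p (heunInvolution l μ ω δ p a) k = a k := by
  have h1 := ha k
  simp only [heunInvolution]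
  have e1 : p - (p - k) = k := by ring
  have e2 : p - (p - k - 1) = k + 1 := by ring
  have e3 : k + 1 - 1 = k := by ring
  rw [e1, e2, e3]
  push_cast
  rw [hp]
  have h2 : 4 * ω ^ 2 * (lam + μ ^ 2) = 1 := by rw [hparam]; field_simp
  linear_combination (-4 * ω ^ 2) * h1 + a k * h2

/-- A solution that vanishes at two consecutive places vanishes. -/
theorem eq_zero (ha : IsHeunCoeff l lam μ δ a) (hμ : μ ≠ 0)
    (hm : ∀ k : ℤ, (k : ℂ) - δ - l / 2 ≠ 0) (hp' : ∀ k : ℤ, (k : ℂ) - δ + l / 2 ≠ 0)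
    {j : ℤ} (h0 : a (j - 1) = 0) (h1 : a j = 0) (k : ℤ) : a k = 0 := by
  have step : ∀ k : ℤ, (a (k - 1) = 0 ∧ a k = 0) ↔ (a (k + 1 - 1) = 0 ∧ a (k + 1) = 0) := by
    intro k
    have h := ha k
    have hmk := hm (k + 1)
    push_cast at hmk
    rw [add_sub_cancel_right]
    constructor
    · rintro ⟨h2, h3⟩
      refine ⟨h3, ?_⟩
      rw [h2, h3] at h
      have : μ * ((k : ℂ) + 1 - δ - l / 2) * a (k + 1) = 0 := by linear_combination h
      simpa [hμ, hmk] using this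
    · rintro ⟨h2, h3⟩
      refine ⟨?_, h2⟩
      rw [h2, h3] at h
      have : μ * ((k : ℂ) - δ + l / 2) * a (k - 1) = 0 := by linear_combination -h
      simpa [hμ, hp' k] using this
  have key : ∀ k : ℤ, a (k - 1) = 0 ∧ a k = 0 := by
    intro k
    induction k using Int.inductionOn' (b := j) with
    | zero => exact ⟨h0, h1⟩
    | succ k _ ih => exact (step k).1 ih
    | pred k _ ih =>
      refine (step (k - 1)).2 ?_
      simpa using ih
  exact (key k).2

/-- The discrete Abel identity: the middle terms cancel when the two recurrences are
cross-multiplied. -/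
theorem casoratian_succ (ha : IsHeunCoeff l lam μ δ a) (hu : IsHeunCoeff l lam μ δ u) (hμ : μ ≠ 0)
    (k : ℤ) : ((k : ℂ) - δ + 1 - l / 2) * casoratian u a (k + 1) =
      -((k : ℂ) - δ + l / 2) * casoratian u a k := by
  have h1 := ha k
  have h2 := hu k
  simp only [casoratian, add_sub_cancel_right]
  apply mul_left_cancel₀ hμ
  linear_combination u k * h1 - a k * h2

theorem exists_eq_const_mul (ha : IsHeunCoeff l lam μ δ a) (hu : IsHeunCoeff l lam μ δ u)
    (hμ : μ ≠ 0) (hm : ∀ k : ℤ, (k : ℂ) - δ - l / 2 ≠ 0)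
    (hp' : ∀ k : ℤ, (k : ℂ) - δ + l / 2 ≠ 0) (hu0 : u ≠ 0) {j : ℤ} (hV : casoratian u a j = 0) :
    ∃ x : ℂ, ∀ k, a k = x * u k := by
  have hne : u (j - 1) ≠ 0 ∨ u j ≠ 0 := by
    by_contra! h
    exact hu0 (funext fun k => hu.eq_zero hμ hm hp' h.1 h.2 k)
  obtain ⟨x, h1, h2⟩ : ∃ x : ℂ, a (j - 1) = x * u (j - 1) ∧ a j = x * u j := by
    simp only [casoratian] at hV
    rcases hne with h | h
    · exact ⟨a (j - 1) / u (j - 1), by field_simp, by field_simp; linear_combination hV⟩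
    · exact ⟨a j / u j, by field_simp; linear_combination -hV, by field_simp⟩
  refine ⟨x, fun k => sub_eq_zero.1 ?_⟩
  exact (ha.sub_const_mul hu x).eq_zero (j := j) hμ hm hp' (by simp [h1]) (by simp [h2]) k

/-- If `u` is a solution fixed up to the sign `ε` by the involution at its central place, it is so
everywhere. -/
theorem involution_eq (hu : IsHeunCoeff l lam μ δ u) (hp : (p : ℂ) = 2 * δ) (hω : ω ≠ 0)
    (hμ : μ ≠ 0) (hm : ∀ k : ℤ, (k : ℂ) - δ - l / 2 ≠ 0)
    (hp' : ∀ k : ℤ, (k : ℂ) - δ + l / 2 ≠ 0) (hparam : lam + μ ^ 2 = 1 / (4 * ω ^ 2)) {ε : ℂ}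
    (hε : ε ^ 2 = 1) {j : ℤ} (hj : heunInvolution l μ ω δ p u j = ε * u j)
    (hj' : p - j = j ∨ p - j - 1 = j) (k : ℤ) :
    heunInvolution l μ ω δ p u k = ε * u k := by
  set v : ℤ → ℂ := fun k => heunInvolution l μ ω δ p u k - ε * u k with hv
  have hsol : IsHeunCoeff l lam μ δ v := (hu.involution hp).sub_const_mul hu ε
  have hvj : v j = 0 := sub_eq_zero.2 hj
  -- Since the involution squares to one and `ε² = 1`, the defect `v` has the opposite sign under
  -- it.
  have hinv : heunInvolution l μ ω δ p v j = -ε * v j := by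
    have h1 := hu.involution_involution hp hω hparam j
    have h2 : heunInvolution l μ ω δ p v j =
        heunInvolution l μ ω δ p (heunInvolution l μ ω δ p u) j
          - ε * heunInvolution l μ ω δ p u j := by
      simp only [hv, heunInvolution]
      ring
    rw [h2, h1, hv]
    linear_combination -u j * hε
  rw [hvj, mul_zero, heunInvolution] at hinv
  refine sub_eq_zero.1 (?_ : v k = 0)
  -- At a central index the involution involves only `v j` and one neighbour, so `v j = 0` forces
  -- that neighbour to vanish and hence all of `v`.
  rcases hj' with h | h
  · rw [h, hvj] at hinv
    refine hsol.eq_zero hμ hm hp' ?_ hvj k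
    simpa [hω, hμ] using hinv
  · rw [h, show p - j = j + 1 by omega, hvj] at hinv
    have hjp : -((j : ℂ) - δ) - l / 2 ≠ 0 := by
      have h3 := hm (j + 1)
      have h4 : (p : ℂ) - j - 1 = j := by exact_mod_cast h
      rw [hp] at h4
      push_cast at h3
      contrapose! h3
      linear_combination h3 - h4
    refine hsol.eq_zero (j := j + 1) hμ hm hp' (by simpa using hvj) ?_ k
    rw [mul_zero μ, sub_zero] at hinv
    exact (mul_eq_zero.1 ((mul_eq_zero.1 hinv).resolve_left (by simpa using hω))).resolve_left hjp

end IsHeunCoeff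

/-! ### Convergence of the infinite matrix products -/

/-- Discrete Gronwall: `‖x‖ + ‖y‖` grows at each step by a factor of at most `1 + ‖α n‖ + ‖β n‖`. -/
theorem norm_add_le_exp_tsum_mul {x y α β : ℕ → ℂ} (hx : ∀ n, x (n + 1) = x n * (1 + α n) + y n)
    (hy : ∀ n, y (n + 1) = x n * β n) (hs : Summable fun n => ‖α n‖ + ‖β n‖) (n : ℕ) :
    ‖x n‖ + ‖y n‖ ≤ Real.exp (∑' n, (‖α n‖ + ‖β n‖)) * (‖x 0‖ + ‖y 0‖) := by
  have h1 : ‖x n‖ + ‖y n‖ ≤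
      Real.exp (∑ i ∈ Finset.range n, (‖α i‖ + ‖β i‖)) * (‖x 0‖ + ‖y 0‖) := by
    induction n with
    | zero => simp
    | succ n ih =>
      rw [Finset.sum_range_succ, Real.exp_add]
      have h2 : ‖x (n + 1)‖ ≤ ‖x n‖ * (1 + ‖α n‖) + ‖y n‖ := by
        rw [hx]
        refine (norm_add_le _ _).trans ?_
        rw [norm_mul]
        gcongr
        exact (norm_add_le _ _).trans (by simp)
      have h3 : ‖y (n + 1)‖ = ‖x n‖ * ‖β n‖ := by rw [hy, norm_mul]
      have h4 : ‖x (n + 1)‖ + ‖y (n + 1)‖ ≤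
          (‖α n‖ + ‖β n‖ + 1) * (‖x n‖ + ‖y n‖) := by
        have := mul_nonneg (add_nonneg (norm_nonneg (α n)) (norm_nonneg (β n))) (norm_nonneg (y n))
        linarith
      calc _ ≤ (‖α n‖ + ‖β n‖ + 1) * (‖x n‖ + ‖y n‖) := h4
        _ ≤ Real.exp (‖α n‖ + ‖β n‖) * (Real.exp (∑ i ∈ Finset.range n, (‖α i‖ + ‖β i‖))
            * (‖x 0‖ + ‖y 0‖)) := by
          gcongr
          exact Real.add_one_le_exp _
        _ = _ := by ring
  refine h1.trans ?_
  gcongr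
  exact hs.sum_le_tsum _ fun i _ => by positivity

/-- The sum `x + y` has increments `(α n + β n) * x n`, which are summable because `x` is bounded,
and `y` tends to `0`. The explicit error bound serves to show that products starting far out are
close to their initial value. -/
theorem exists_tendsto_of_summable_perturbation {x y α β : ℕ → ℂ}
    (hx : ∀ n, x (n + 1) = x n * (1 + α n) + y n)
    (hy : ∀ n, y (n + 1) = x n * β n) (hs : Summable fun n => ‖α n‖ + ‖β n‖) :
    ∃ X : ℂ, Tendsto x atTop (𝓝 X) ∧ Tendsto y atTop (𝓝 0) ∧
      ‖X - (x 0 + y 0)‖ ≤ (∑' n, (‖α n‖ + ‖β n‖)) *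
        (Real.exp (∑' n, (‖α n‖ + ‖β n‖)) * (‖x 0‖ + ‖y 0‖)) := by
  set B := Real.exp (∑' n, (‖α n‖ + ‖β n‖)) * (‖x 0‖ + ‖y 0‖) with hB
  have hxB : ∀ n, ‖x n‖ ≤ B := fun n =>
    (le_add_of_nonneg_right (norm_nonneg _)).trans (norm_add_le_exp_tsum_mul hx hy hs n)
  have hd : ∀ n, dist (x n + y n) (x (n + 1) + y (n + 1)) ≤ (‖α n‖ + ‖β n‖) * B := by
    intro n
    rw [dist_comm, dist_eq_norm, hx, hy,
      show x n * (1 + α n) + y n + x n * β n - (x n + y n) = (α n + β n) * x n by ring, norm_mul]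
    gcongr
    · exact norm_add_le _ _
    · exact hxB n
  have hsB := hs.mul_right B
  obtain ⟨X, hX⟩ := cauchySeq_tendsto_of_complete (cauchySeq_of_dist_le_of_summable _ hd hsB)
  have hy0 : Tendsto y atTop (𝓝 0) := by
    rw [← tendsto_add_atTop_iff_nat 1]
    refine squeeze_zero_norm (a := fun n => (‖α n‖ + ‖β n‖) * B) (fun n => ?_)
      hsB.tendsto_atTop_zero
    rw [hy, norm_mul, mul_comm]
    gcongr
    · simp
    · exact hxB n
  refine ⟨X, by simpa using hX.sub hy0, hy0, ?_⟩
  have := dist_le_tsum_of_dist_le_of_tendsto₀ _ hd hsB hX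
  rwa [dist_comm, dist_eq_norm, tsum_mul_right] at this

theorem summable_norm_inv_int_add_sq_sub (k : ℤ) (a b : ℂ) :
    Summable fun n : ℕ => ‖((((k + n : ℤ) : ℂ) - a) ^ 2 - b ^ 2 / 4)⁻¹‖ := by
  have hlow : ∀ c : ℂ, ∀ᶠ n : ℕ in atTop, (n : ℝ) / 2 ≤ ‖(n : ℂ) + c‖ := by
    intro c
    filter_upwards [eventually_ge_atTop ⌈2 * ‖c‖⌉₊] with n hn
    have h1 : 2 * ‖c‖ ≤ n := Nat.ceil_le.1 hn
    have h2 : ‖(n : ℂ)‖ - ‖c‖ ≤ ‖(n : ℂ) + c‖ := norm_sub_le_norm_add _ _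
    rw [Complex.norm_natCast] at h2
    linarith
  have hsum : Summable fun n : ℕ => 4 * (1 / (n : ℝ) ^ 2) :=
    (Real.summable_one_div_nat_pow.2 one_lt_two).mul_left 4
  refine Summable.of_norm_bounded_eventually_nat hsum ?_
  filter_upwards [hlow (k - a - b / 2), hlow (k - a + b / 2), eventually_gt_atTop 0] with n h1 h2 hn
  have hn' : (0 : ℝ) < n := by exact_mod_cast hn
  rw [norm_norm, norm_inv, show (((k + n : ℤ) : ℂ) - a) ^ 2 - b ^ 2 / 4 =
    ((n : ℂ) + (k - a - b / 2)) * ((n : ℂ) + (k - a + b / 2)) by push_cast; ring, norm_mul]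
  have h3 : (n : ℝ) ^ 2 / 4 ≤ ‖(n : ℂ) + (k - a - b / 2)‖ * ‖(n : ℂ) + (k - a + b / 2)‖ := by
    calc (n : ℝ) ^ 2 / 4 = (n / 2) * (n / 2) := by ring
      _ ≤ _ := by gcongr
  calc _ ≤ ((n : ℝ) ^ 2 / 4)⁻¹ := by gcongr
    _ = _ := by field_simp

theorem partialProd_succ (M : ℤ → Matrix (Fin 2) (Fin 2) ℂ) (k : ℤ) (N : ℕ) :
    partialProd M k (N + 1) = partialProd M k N * M (k + N) := by
  simp [partialProd, List.range_succ]

theorem partialProd_succ' (M : ℤ → Matrix (Fin 2) (Fin 2) ℂ) (k : ℤ) (N : ℕ) :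
    partialProd M k (N + 1) = M k * partialProd M (k + 1) N := by
  induction N with
  | zero => simp [partialProd]
  | succ N ih =>
    rw [partialProd_succ, ih, partialProd_succ, Matrix.mul_assoc]
    push_cast
    rw [show k + 1 + (N : ℤ) = k + (N + 1) by ring]

/-- Each row of the partial products follows the perturbed recursion with `α, β = O(1/n²)`. The
limits have zero second column. -/
theorem exists_hasInfiniteProd_heunMatrix (l lam μ δ : ℂ) :
    ∃ R : ℤ → Matrix (Fin 2) (Fin 2) ℂ,
      (∀ k, HasInfiniteProd (fun j => heunMatrix l lam μ ((j : ℂ) - δ)) k (R k)) ∧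
      (∀ k : ℤ, R k = heunMatrix l lam μ ((k : ℂ) - δ) * R (k + 1)) ∧
      Tendsto (fun n : ℕ => R n 0 0) atTop (𝓝 1) := by
  set M : ℤ → Matrix (Fin 2) (Fin 2) ℂ := fun j => heunMatrix l lam μ ((j : ℂ) - δ) with hM
  set α : ℤ → ℂ := fun k => lam / (((k : ℂ) - δ) ^ 2 - l ^ 2 / 4) with hα
  set β : ℤ → ℂ := fun k => μ ^ 2 / (((k : ℂ) - δ) ^ 2 - l ^ 2 / 4) with hβ
  have hs : ∀ k : ℤ, Summable fun n : ℕ => ‖α (k + n)‖ + ‖β (k + n)‖ := by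
    intro k
    have h := summable_norm_inv_int_add_sq_sub k δ l
    simp only [hα, hβ, div_eq_mul_inv _ (_ - _ : ℂ), norm_mul]
    exact (h.mul_left _).add (h.mul_left _)
  have h0 : ∀ (k : ℤ) i n, partialProd M k (n + 1) i 0 =
      partialProd M k n i 0 * (1 + α (k + n)) + partialProd M k n i 1 := by
    intro k i n
    rw [partialProd_succ, Matrix.mul_apply, Fin.sum_univ_two]
    simp [hM, heunMatrix, hα]
  have h1 : ∀ (k : ℤ) i n, partialProd M k (n + 1) i 1 =
      partialProd M k n i 0 * β (k + n) := by
    intro k i n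
    rw [partialProd_succ, Matrix.mul_apply, Fin.sum_univ_two]
    simp [hM, heunMatrix, hβ]
  choose X hX hY hXn using fun k i =>
    exists_tendsto_of_summable_perturbation (x := fun n => partialProd M k n i 0)
      (y := fun n => partialProd M k n i 1) (h0 k i) (h1 k i) (hs k)
  have hR : ∀ k, HasInfiniteProd M k !![X k 0, 0; X k 1, 0] := by
    intro k
    refine tendsto_pi_nhds.2 fun i => tendsto_pi_nhds.2 fun j => ?_
    fin_cases i <;> fin_cases j
    · exact hX k 0
    · exact hY k 0
    · exact hX k 1
    · exact hY k 1
  refine ⟨fun k => !![X k 0, 0; X k 1, 0], hR, fun k => ?_, ?_⟩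
  · have h2 := (tendsto_add_atTop_iff_nat 1).2 (hR k)
    simp only [partialProd_succ'] at h2
    exact tendsto_nhds_unique h2 ((hR (k + 1)).const_mul (M k))
  -- The empty product has first row `(1, 0)`, so the distance of `R n 0 0` from `1` is controlled
  -- by a tail of a convergent series.
  · have ht : Tendsto (fun n : ℕ => ∑' j : ℕ, (‖α (n + j)‖ + ‖β (n + j)‖)) atTop (𝓝 0) := by
      have := tendsto_sum_nat_add fun j : ℕ => ‖α j‖ + ‖β j‖
      refine this.congr fun n => tsum_congr fun j => ?_
      push_cast
      rw [add_comm (j : ℤ)]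
    rw [tendsto_iff_norm_sub_tendsto_zero]
    refine squeeze_zero (fun n => norm_nonneg _) (fun n => ?_)
      (by simpa using ht.mul (ht.rexp.mul_const 1))
    simpa [partialProd] using hXn n 0

/-! ### The recessive solution and its uniqueness -/

/-- The scaling is `μ^k / Γ(k - δ - l/2 + 1)`; `hm` keeps the argument away from the poles of `Γ`.
-/
theorem exists_gamma_normalization {μ δ : ℂ} (l : ℂ) (hμ : μ ≠ 0)
    (hm : ∀ k : ℤ, (k : ℂ) - δ - l / 2 ≠ 0) :
    ∃ c : ℤ → ℂ, (∀ k, c k ≠ 0) ∧ ∀ k : ℤ, c (k + 1) * ((k : ℂ) + 1 - δ - l / 2) = μ * c k := by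
  have hΓ : ∀ k : ℤ, Complex.Gamma ((k : ℂ) - δ - l / 2 + 1) ≠ 0 := by
    intro k
    refine Complex.Gamma_ne_zero fun m h => hm (k + m + 1) ?_
    push_cast
    linear_combination h
  refine ⟨fun k => μ ^ k / Complex.Gamma ((k : ℂ) - δ - l / 2 + 1), fun k =>
    div_ne_zero (zpow_ne_zero _ hμ) (hΓ k), fun k => ?_⟩
  have h1 := hm (k + 1)
  have h2 := hΓ k
  push_cast at h1 ⊢
  rw [show (k : ℂ) + 1 - δ - l / 2 = (k : ℂ) - δ - l / 2 + 1 by ring] at h1 ⊢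
  rw [Complex.Gamma_add_one _ h1, zpow_add_one₀ hμ]
  generalize (k : ℂ) - δ - l / 2 + 1 = w at h1 h2 ⊢
  field_simp

theorem tendsto_norm_natCast_add_atTop (c : ℂ) :
    Tendsto (fun n : ℕ => ‖(n : ℂ) + c‖) atTop atTop := by
  refine tendsto_atTop_mono (f := fun n : ℕ => (n : ℝ) + -‖c‖) (fun n => ?_)
    (tendsto_atTop_add_const_right _ _ tendsto_natCast_atTop_atTop)
  have h2 : ‖(n : ℂ)‖ - ‖c‖ ≤ ‖(n : ℂ) + c‖ := norm_sub_le_norm_add _ _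
  rw [Complex.norm_natCast] at h2
  linarith

/-- The first columns of the infinite products give a nonzero solution of the recurrence that
decays faster than any exponential at `+∞`. -/
theorem exists_recessive_solution {l lam μ δ : ℂ} (hμ : μ ≠ 0)
    (hm : ∀ k : ℤ, (k : ℂ) - δ - l / 2 ≠ 0) (hp' : ∀ k : ℤ, (k : ℂ) - δ + l / 2 ≠ 0)
    {R : ℤ → Matrix (Fin 2) (Fin 2) ℂ}
    (hR : ∀ k : ℤ, R k = heunMatrix l lam μ ((k : ℂ) - δ) * R (k + 1))
    (hR1 : Tendsto (fun n : ℕ => R n 0 0) atTop (𝓝 1)) :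
    ∃ c : ℤ → ℂ, (∀ k, c k ≠ 0) ∧
      (∀ k : ℤ, c (k + 1) * ((k : ℂ) + 1 - δ - l / 2) = μ * c k) ∧
      IsHeunCoeff l lam μ δ (fun k => c k * R k 1 0) ∧ (fun k => c k * R k 1 0) ≠ 0 ∧
      ∀ r : ℝ, 0 < r → Summable fun n : ℕ => ‖c n * R n 1 0‖ * r ^ n := by
  obtain ⟨c, hc0, hc⟩ := exists_gamma_normalization l hμ hm
  have hR10 : ∀ k, R k 1 0 = R (k + 1) 0 0 := by
    intro k
    rw [hR k, Matrix.mul_apply, Fin.sum_univ_two]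
    simp [heunMatrix]
  have hR00 : ∀ k : ℤ, (((k : ℂ) - δ) ^ 2 - l ^ 2 / 4) * R k 0 0 =
      (((k : ℂ) - δ) ^ 2 - l ^ 2 / 4 + lam) * R k 1 0 + μ ^ 2 * R (k + 1) 1 0 := by
    intro k
    have hD : ((k : ℂ) - δ) ^ 2 - l ^ 2 / 4 ≠ 0 := by
      rw [show ((k : ℂ) - δ) ^ 2 - l ^ 2 / 4 = ((k : ℂ) - δ - l / 2) * ((k : ℂ) - δ + l / 2) by ring]
      exact mul_ne_zero (hm k) (hp' k)
    rw [hR10 k]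
    conv_lhs => rw [hR k, Matrix.mul_apply, Fin.sum_univ_two]
    simp only [heunMatrix, Matrix.of_apply, Matrix.cons_val', Matrix.cons_val_zero,
      Matrix.cons_val_one, Matrix.cons_val_fin_one]
    generalize ((k : ℂ) - δ) ^ 2 - l ^ 2 / 4 = D at hD ⊢
    field_simp
  have hlim : Tendsto (fun n : ℕ => R n 1 0) atTop (𝓝 1) := by
    simp only [hR10]
    exact_mod_cast (tendsto_add_atTop_iff_nat 1).2 hR1
  refine ⟨c, hc0, hc, fun k => ?_, fun h => ?_, fun r hr => ?_⟩
  · have h1 := hc k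
    have h2 := hc (k - 1)
    have h3 := hR00 k
    rw [sub_add_cancel] at h2
    push_cast at h2
    have h4 : R (k - 1) 1 0 = R k 0 0 := by rw [hR10, sub_add_cancel]
    simp only [h4]
    linear_combination (-c k) * h3 + μ * R (k + 1) 1 0 * h1 + ((k : ℂ) - δ + l / 2) * R k 0 0 * h2
  · obtain ⟨n, hn⟩ := (hlim.eventually_ne one_ne_zero).exists
    exact mul_ne_zero (hc0 n) hn (congrFun h n)
  -- The ratio `c (n + 1) / c n = μ / (n + 1 - δ - l/2)` tends to `0`, while `R n 1 0` stays
  -- bounded.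
  · have hcs : Summable fun n : ℕ => c n * (r : ℂ) ^ n := by
      have hr' : (r : ℂ) ≠ 0 := by exact_mod_cast hr.ne'
      refine summable_of_ratio_test_tendsto_lt_one (l := 0) one_pos
        (Eventually.of_forall fun n => mul_ne_zero (hc0 n) (pow_ne_zero _ hr')) ?_
      have h1 := (tendsto_norm_natCast_add_atTop (1 - δ - l / 2)).const_div_atTop (‖μ‖ * r)
      refine h1.congr fun n => ?_
      have h2 := hc n
      have h3 := hm (n + 1)
      push_cast at h2 h3 ⊢
      have h5 : (n : ℂ) + (1 - δ - l / 2) ≠ 0 := by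
        contrapose! h3
        linear_combination h3
      have h4 : c (n + 1) = μ * c n / ((n : ℂ) + (1 - δ - l / 2)) := by
        rw [eq_div_iff h5]
        linear_combination h2
      rw [h4]
      simp only [norm_mul, norm_div, norm_pow, Complex.norm_real, Real.norm_of_nonneg hr.le]
      have := norm_ne_zero_iff.2 (hc0 n)
      have := norm_ne_zero_iff.2 h5
      rw [pow_succ]
      field_simp
    refine summable_of_isBigO_nat hcs.norm ?_
    have h1 := (Asymptotics.isBigO_refl (fun n : ℕ => ‖c n * (r : ℂ) ^ n‖) atTop).mul
      (hlim.norm.isBigO_one ℝ)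
    refine (h1.congr_left fun n => ?_).congr_right fun n => mul_one _
    simp only [norm_mul, norm_pow, Complex.norm_real, Real.norm_of_nonneg hr.le]
    ring

namespace IsHeunCoeff

variable {l lam μ ω δ : ℂ} {p : ℤ} {a u : ℤ → ℂ}

/-- By the Abel identity, consecutive Casoratians have ratio of modulus tending to `1`, so `2^n`
times the Casoratian is eventually nondecreasing in norm. It also tends to `0`, because `u` beats
every exponential; hence it vanishes somewhere. -/
theorem exists_casoratian_eq_zero (ha : IsHeunCoeff l lam μ δ a) (hu : IsHeunCoeff l lam μ δ u)
    (hμ : μ ≠ 0) (hm : ∀ k : ℤ, (k : ℂ) - δ - l / 2 ≠ 0)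
    (hus : ∀ r : ℝ, 0 < r → Summable fun n : ℕ => ‖u n‖ * r ^ n) {C ρ : ℝ} (hρ : 0 < ρ)
    (hab : ∀ n : ℕ, ‖a n‖ ≤ C * ρ ^ n) : ∃ j, casoratian u a j = 0 := by
  have hev : ∀ᶠ n : ℕ in atTop, 2 ^ n * ‖casoratian u a (n + 1)‖ ≤
      2 ^ (n + 1) * ‖casoratian u a (n + 1 + 1)‖ := by
    have h1 := eventually_ge_atTop ⌈‖2 - δ - l / 2‖ + 2 * ‖1 - δ + l / 2‖⌉₊
    filter_upwards [h1] with n hn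
    have hn' := Nat.ceil_le.1 hn
    have h2 := congrArg norm (ha.casoratian_succ hu hμ (n + 1))
    have h3 := hm (n + 1 + 1)
    push_cast at h2 h3
    rw [norm_mul, norm_mul, norm_neg] at h2
    have e1 : ‖(n : ℂ) + 1 - δ + 1 - l / 2‖ ≤ n + ‖2 - δ - l / 2‖ := by
      rw [show (n : ℂ) + 1 - δ + 1 - l / 2 = n + (2 - δ - l / 2) by ring]
      exact (norm_add_le _ _).trans (by simp)
    have e2 : n - ‖1 - δ + l / 2‖ ≤ ‖(n : ℂ) + 1 - δ + l / 2‖ := by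
      rw [show (n : ℂ) + 1 - δ + l / 2 = n + (1 - δ + l / 2) by ring]
      simpa using norm_sub_le_norm_add (n : ℂ) (1 - δ + l / 2)
    have e3 : 0 < ‖(n : ℂ) + 1 - δ + 1 - l / 2‖ := by
      rw [norm_pos_iff]
      contrapose! h3
      linear_combination h3
    rw [pow_succ, mul_assoc]
    gcongr
    refine le_of_mul_le_mul_left ?_ e3
    calc _ ≤ (2 * ‖(n : ℂ) + 1 - δ + l / 2‖) * ‖casoratian u a (n + 1)‖ := by
          gcongr
          linarith
      _ = _ := by
          rw [mul_assoc, ← h2]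
          ring
  have hlim : Tendsto (fun n : ℕ => 2 ^ n * ‖casoratian u a (n + 1)‖) atTop (𝓝 0) := by
    have h1 := (hus (2 * ρ) (by positivity)).tendsto_atTop_zero
    have h2 := (tendsto_add_atTop_iff_nat 1).2 h1
    have h3 := (h1.const_mul (C * ρ)).add (h2.const_mul (C / (2 * ρ)))
    simp only [mul_zero, add_zero] at h3
    refine squeeze_zero (fun n => by positivity) (fun n => ?_) h3
    have h4 := hab n
    have h5 := hab (n + 1)
    push_cast at h5
    simp only [casoratian, add_sub_cancel_right]
    calc _ ≤ 2 ^ n * (‖u n‖ * (C * ρ ^ (n + 1)) + ‖u (n + 1)‖ * (C * ρ ^ n)) := by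
          gcongr
          refine (norm_sub_le _ _).trans ?_
          rw [norm_mul, norm_mul]
          gcongr
      _ = _ := by
          push_cast
          rw [mul_pow, mul_pow, pow_succ ρ, pow_succ (2 : ℝ)]
          field_simp
  obtain ⟨N, hN⟩ := eventually_atTop.1 hev
  refine ⟨N + 1, ?_⟩
  have hmono : ∀ n ≥ N, 2 ^ N * ‖casoratian u a (N + 1)‖ ≤ 2 ^ n * ‖casoratian u a (n + 1)‖ := by
    intro n hn
    induction n, hn using Nat.le_induction with
    | base => exact le_rfl
    | succ n hn ih =>
      refine ih.trans ?_
      exact_mod_cast hN n hn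
  have h1 := ge_of_tendsto hlim (eventually_atTop.2 ⟨N, hmono⟩)
  have h2 : (0 : ℝ) < 2 ^ N := by positivity
  exact norm_le_zero_iff.1 (nonpos_of_mul_nonpos_right h1 h2)

/-- A solution of exponential growth at `+∞` is a multiple of the recessive one. -/
theorem exists_eq_const_mul_recessive (ha : IsHeunCoeff l lam μ δ a) (hu : IsHeunCoeff l lam μ δ u)
    (hμ : μ ≠ 0) (hm : ∀ k : ℤ, (k : ℂ) - δ - l / 2 ≠ 0)
    (hp' : ∀ k : ℤ, (k : ℂ) - δ + l / 2 ≠ 0) (hu0 : u ≠ 0)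
    (hus : ∀ r : ℝ, 0 < r → Summable fun n : ℕ => ‖u n‖ * r ^ n) {C ρ : ℝ} (hρ : 0 < ρ)
    (hab : ∀ n : ℕ, ‖a n‖ ≤ C * ρ ^ n) : ∃ x : ℂ, ∀ k, a k = x * u k := by
  obtain ⟨j, hj⟩ := ha.exists_casoratian_eq_zero hu hμ hm hus hρ hab
  exact ha.exists_eq_const_mul hu hμ hm hp' hu0 hj

/-- Geometric growth of `a` at `-∞` becomes geometric growth of its image at `+∞`. Both are then
multiples of `u`, so `u` is an eigenvector of an involution. -/
theorem exists_involution_eq (ha : IsHeunCoeff l lam μ δ a) (hu : IsHeunCoeff l lam μ δ u)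
    (hp : (p : ℂ) = 2 * δ) (hω : ω ≠ 0) (hparam : lam + μ ^ 2 = 1 / (4 * ω ^ 2))
    (hμ : μ ≠ 0) (hm : ∀ k : ℤ, (k : ℂ) - δ - l / 2 ≠ 0)
    (hp' : ∀ k : ℤ, (k : ℂ) - δ + l / 2 ≠ 0) (hu0 : u ≠ 0)
    (hus : ∀ r : ℝ, 0 < r → Summable fun n : ℕ => ‖u n‖ * r ^ n) (ha0 : a ≠ 0) {C ρ : ℝ}
    (hρ : 0 < ρ) (hab : ∀ k : ℤ, ‖a k‖ ≤ C * ρ ^ k) :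
    ∃ ε : ℂ, ε ^ 2 = 1 ∧ ∀ k, heunInvolution l μ ω δ p u k = ε * u k := by
  obtain ⟨x, hx⟩ := ha.exists_eq_const_mul_recessive hu hμ hm hp' hu0 hus (C := C) hρ
    fun n => by simpa using hab n
  have hx0 : x ≠ 0 := by
    rintro rfl
    exact ha0 (funext fun k => by simp [hx])
  have hC : 0 ≤ C := by simpa using (norm_nonneg (a 0)).trans (hab 0)
  obtain ⟨y, hy⟩ := (ha.involution (ω := ω) hp).exists_eq_const_mul_recessive hu hμ hm hp' hu0 hus
    -- Reflection turns `ρ` into `1/ρ`; the extra `2` absorbs the linear factor in `n`.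
    (C := ‖2 * ω‖ * ((1 + ‖δ - l / 2‖) * (C * ρ ^ p) + ‖μ‖ * (C * ρ ^ (p - 1)))) (ρ := 2 / ρ)
    (by positivity) fun n => by
      have h1 := hab (p - n)
      have h2 := hab (p - n - 1)
      have h3 : ‖-((n : ℂ) - δ) - l / 2‖ ≤ (1 + ‖δ - l / 2‖) * 2 ^ n := by
        have e1 : ‖-((n : ℂ) - δ) - l / 2‖ ≤ n + ‖δ - l / 2‖ := by
          rw [show -((n : ℂ) - δ) - l / 2 = -n + (δ - l / 2) by ring]
          exact (norm_add_le _ _).trans (by simp)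
        have e2 : (n : ℝ) ≤ 2 ^ n := by exact_mod_cast (Nat.lt_two_pow_self).le
        have e3 : (1 : ℝ) ≤ 2 ^ n := one_le_pow₀ one_le_two
        nlinarith [norm_nonneg (δ - l / 2)]
      rw [zpow_sub₀ hρ.ne', zpow_natCast] at h1
      rw [show p - n - 1 = p - 1 - n by ring, zpow_sub₀ hρ.ne' (p - 1), zpow_natCast] at h2
      simp only [heunInvolution]
      rw [norm_mul, mul_assoc]
      gcongr
      refine (norm_sub_le _ _).trans ?_
      rw [norm_mul, norm_mul, show p - n - 1 = p - 1 - n by ring]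
      push_cast
      calc _ ≤ ((1 + ‖δ - l / 2‖) * 2 ^ n) * (C * (ρ ^ p / ρ ^ n)) +
            ‖μ‖ * (C * (ρ ^ (p - 1) / ρ ^ n)) * 2 ^ n := by
            refine add_le_add (by gcongr) ?_
            refine (mul_le_mul_of_nonneg_left h2 (norm_nonneg μ)).trans ?_
            exact le_mul_of_one_le_right (by positivity) (one_le_pow₀ one_le_two)
        _ = _ := by
            rw [div_pow]
            ring
  have hfix : ∀ k, heunInvolution l μ ω δ p u k = y / x * u k := by
    intro k
    have h1 := hy k
    simp only [heunInvolution, hx] at h1 ⊢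
    field_simp
    linear_combination h1
  refine ⟨y / x, ?_, hfix⟩
  obtain ⟨k, hk⟩ := Function.ne_iff.1 hu0
  have h1 := hu.involution_involution hp hω hparam k
  rw [show heunInvolution l μ ω δ p u = fun k => y / x * u k from funext hfix] at h1
  have h2 := hfix k
  simp only [heunInvolution] at h1 h2
  refine mul_right_cancel₀ hk ?_
  linear_combination h1 - y / x * h2

/-- Up to sign, `u (-n)` is a combination of `u (n + p)` and `u (n + p - 1)` with coefficients at
most linear in `n`. -/
theorem summable_of_involution_eq {ε : ℂ} (hε : ε ^ 2 = 1)
    (hfix : ∀ k, heunInvolution l μ ω δ p u k = ε * u k)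
    (hus : ∀ r : ℝ, 0 < r → Summable fun n : ℕ => ‖u n‖ * r ^ n) {r : ℝ} (hr : 0 < r) :
    Summable fun k : ℤ => ‖u k‖ * r ^ k := by
  have hshift : ∀ (q : ℤ) (r : ℝ), 0 < r → Summable fun n : ℕ => ‖u (n + q)‖ * r ^ n := by
    intro q r hr
    rw [← summable_nat_add_iff (-q).toNat]
    have h1 := ((summable_nat_add_iff (q + (-q).toNat).toNat).2 (hus r hr)).mul_right (r ^ (-q))
    refine h1.congr fun n => ?_
    have e1 : ((n + (q + (-q).toNat).toNat : ℕ) : ℤ) = ((n + (-q).toNat : ℕ) : ℤ) + q := by omega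
    rw [e1, mul_assoc, ← zpow_natCast, ← zpow_add₀ hr.ne', e1, add_neg_cancel_right, zpow_natCast]
  have hεn : ‖ε‖ = 1 := by
    have : ‖ε‖ ^ 2 = 1 := by rw [← norm_pow, hε, norm_one]
    exact (pow_eq_one_iff_of_nonneg (norm_nonneg _) two_ne_zero).1 this
  refine Summable.of_nat_of_neg (by simpa using hus r hr) ?_
  have h1 := ((hshift p (2 * r⁻¹) (by positivity)).mul_left ((1 + ‖δ - l / 2‖))).add
    ((hshift (p - 1) r⁻¹ (by positivity)).mul_left ‖μ‖)
  refine Summable.of_nonneg_of_le (fun n => by positivity) (fun n => ?_) (h1.mul_left ‖2 * ω‖)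
  have h2 := congrArg norm (hfix (-n))
  rw [norm_mul, hεn, one_mul, heunInvolution] at h2
  rw [← h2, norm_mul, mul_assoc]
  gcongr
  rw [zpow_neg, zpow_natCast, mul_pow, inv_pow]
  have h3 : ‖-(((-n : ℤ) : ℂ) - δ) - l / 2‖ ≤ (1 + ‖δ - l / 2‖) * 2 ^ n := by
    push_cast
    have e1 : ‖-(-(n : ℂ) - δ) - l / 2‖ ≤ n + ‖δ - l / 2‖ := by
      rw [show -(-(n : ℂ) - δ) - l / 2 = n + (δ - l / 2) by ring]
      exact (norm_add_le _ _).trans (by simp)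
    have e2 : (n : ℝ) ≤ 2 ^ n := by exact_mod_cast (Nat.lt_two_pow_self).le
    have e3 : (1 : ℝ) ≤ 2 ^ n := one_le_pow₀ one_le_two
    nlinarith [norm_nonneg (δ - l / 2)]
  rw [show p - -(n : ℤ) = n + p by ring, show (n : ℤ) + p - 1 = n + (p - 1) by ring]
  calc _ ≤ (((1 + ‖δ - l / 2‖) * 2 ^ n) * ‖u (n + p)‖ + ‖μ‖ * ‖u (n + (p - 1))‖) * (r ^ n)⁻¹ := by
        gcongr
        refine (norm_sub_le _ _).trans ?_
        rw [norm_mul, norm_mul]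
        gcongr
    _ = _ := by ring

end IsHeunCoeff

/-! ### Laurent series in the logarithmic coordinate -/

/-- The coefficients of a Laurent series that converges on the whole of `ℂ \ {0}`. -/
def IsEntireLaurent (a : ℤ → ℂ) : Prop := ∀ r : ℝ, 0 < r → Summable fun k : ℤ => ‖a k‖ * r ^ k

/-- The function `z ^ b * ∑ a k * z ^ k` in the coordinate `t = log z`. -/
def laurentExp (b : ℂ) (a : ℤ → ℂ) (t : ℂ) : ℂ := ∑' k : ℤ, a k * Complex.exp ((b + k) * t)

namespace IsEntireLaurent

variable {a : ℤ → ℂ}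

/-- These are the coefficients of the `t`-derivative. The bound `|k| ≤ 2^k + 2^{-k}` trades the
factor `k` for convergence at radii `2r` and `r/2`. -/
theorem add_mul (ha : IsEntireLaurent a) (b : ℂ) : IsEntireLaurent fun k => (b + k) * a k := by
  intro r hr
  have h1 := ((ha r hr).mul_left ‖b‖).add
    ((ha (2 * r) (by positivity)).add (ha (2⁻¹ * r) (by positivity)))
  refine Summable.of_nonneg_of_le (fun k => by positivity) (fun k => ?_) h1
  have h2 : ‖(k : ℂ)‖ ≤ (2 : ℝ) ^ k + (2⁻¹ : ℝ) ^ k := by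
    rw [Complex.norm_intCast, inv_zpow']
    have key : ∀ n : ℕ, (n : ℝ) ≤ (2 : ℝ) ^ n := fun n => by
      exact_mod_cast (Nat.lt_two_pow_self).le
    obtain ⟨n, rfl | rfl⟩ := k.eq_nat_or_neg
    · have h3 : (0 : ℝ) < 2 ^ (-(n : ℤ)) := by positivity
      have h4 := key n
      rw [Int.cast_natCast, abs_of_nonneg (Nat.cast_nonneg _), zpow_natCast]
      linarith
    · have h3 : (0 : ℝ) < 2 ^ (-(n : ℤ)) := by positivity
      have h4 := key n
      rw [neg_neg, Int.cast_neg, abs_neg, Int.cast_natCast, abs_of_nonneg (Nat.cast_nonneg _),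
        zpow_natCast]
      linarith
  rw [norm_mul, mul_zpow, mul_zpow]
  calc _ ≤ (‖b‖ + ((2 : ℝ) ^ k + (2⁻¹ : ℝ) ^ k)) * ‖a k‖ * r ^ k := by
        gcongr
        exact (norm_add_le _ _).trans (by gcongr)
    _ = _ := by ring

theorem exists_bound (ha : IsEntireLaurent a) (b : ℂ) (T : ℝ) :
    ∃ v : ℤ → ℝ, Summable v ∧
      ∀ (k : ℤ) (t : ℂ), t ∈ Metric.ball 0 T → ‖a k * Complex.exp ((b + k) * t)‖ ≤ v k := by
  refine ⟨_, ((ha (Real.exp T) (Real.exp_pos _)).add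
    (ha (Real.exp (-T)) (Real.exp_pos _))).mul_left (Real.exp (‖b‖ * T)), fun k t ht => ?_⟩
  rw [mem_ball_zero_iff] at ht
  have h1 : ((b + k) * t).re ≤ ‖b‖ * T + |(k : ℝ)| * T := by
    refine (Complex.re_le_norm _).trans ?_
    rw [norm_mul, ← _root_.add_mul]
    gcongr
    exact (norm_add_le _ _).trans (by simp)
  have h2 : Real.exp (|(k : ℝ)| * T) ≤ Real.exp T ^ k + Real.exp (-T) ^ k := by
    have hE : ∀ x : ℝ, Real.exp x ^ k = Real.exp (k * x) := fun x => by
      rw [← Real.rpow_intCast, ← Real.exp_mul, mul_comm]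
    rw [hE, hE]
    rcases abs_cases (k : ℝ) with ⟨h, _⟩ | ⟨h, _⟩ <;> rw [h]
    · linarith [Real.exp_pos (k * -T)]
    · rw [neg_mul, ← mul_neg]
      linarith [Real.exp_pos (k * T)]
  rw [norm_mul, Complex.norm_exp]
  calc _ ≤ ‖a k‖ * (Real.exp (‖b‖ * T) * Real.exp (|(k : ℝ)| * T)) := by
        rw [← Real.exp_add]
        gcongr
    _ ≤ ‖a k‖ * (Real.exp (‖b‖ * T) * (Real.exp T ^ k + Real.exp (-T) ^ k)) := by gcongr
    _ = _ := by ring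

theorem hasSum (ha : IsEntireLaurent a) (b t : ℂ) :
    HasSum (fun k : ℤ => a k * Complex.exp ((b + k) * t)) (laurentExp b a t) := by
  obtain ⟨v, hv, hb⟩ := ha.exists_bound b (‖t‖ + 1)
  exact (Summable.of_norm_bounded hv fun k => hb k t (by simp)).hasSum

theorem hasDerivAt (ha : IsEntireLaurent a) (b t : ℂ) :
    HasDerivAt (laurentExp b a) (laurentExp b (fun k => (b + k) * a k) t) t := by
  obtain ⟨v, hv, hb⟩ := ha.exists_bound b (‖t‖ + 1)
  have ht : t ∈ Metric.ball (0 : ℂ) (‖t‖ + 1) := by simp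
  have hd : ∀ k : ℤ, Differentiable ℂ fun t => a k * Complex.exp ((b + k) * t) := by
    intro k
    fun_prop
  have h1 := (Complex.differentiableOn_tsum_of_summable_norm hv (fun k => (hd k).differentiableOn)
    Metric.isOpen_ball hb).differentiableAt (Metric.isOpen_ball.mem_nhds ht)
  have h2 := Complex.hasSum_deriv_of_summable_norm hv (fun k => (hd k).differentiableOn)
    Metric.isOpen_ball hb ht
  have h3 : deriv (laurentExp b a) t = laurentExp b (fun k => (b + k) * a k) t := by
    rw [show laurentExp b a = fun t => ∑' k : ℤ, a k * Complex.exp ((b + k) * t) from rfl,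
      ← h2.tsum_eq]
    refine tsum_congr fun k => ?_
    have h4 : HasDerivAt (fun t => (b + k) * t) (b + k) t := by
      simpa using (hasDerivAt_id t).const_mul (b + (k : ℂ))
    rw [(h4.cexp.const_mul (a k)).deriv]
    ring
  rw [← h3]
  exact h1.hasDerivAt

theorem hasSum_shift (ha : IsEntireLaurent a) (b t : ℂ) (q : ℤ) :
    HasSum (fun k : ℤ => a (k + q) * Complex.exp ((b + k) * t))
      (Complex.exp (-q * t) * laurentExp b a t) := by
  have h1 := ((Equiv.addRight q).hasSum_iff.2 (ha.hasSum b t)).mul_left (Complex.exp (-q * t))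
  refine h1.congr_fun ?_
  intro k
  simp only [Function.comp_apply, Equiv.coe_addRight]
  rw [mul_left_comm, ← Complex.exp_add]
  congr 2
  push_cast
  ring

theorem laurentExp_add_two_pi_I (b : ℂ) (a : ℤ → ℂ) (t : ℂ) :
    laurentExp b a (t + 2 * Real.pi * Complex.I) =
      Complex.exp (2 * Real.pi * Complex.I * b) * laurentExp b a t := by
  simp only [laurentExp]
  rw [← tsum_mul_left]
  refine tsum_congr fun k => ?_
  rw [show (b + k) * (t + 2 * Real.pi * Complex.I) =
    2 * Real.pi * Complex.I * b + (b + k) * t + k * (2 * Real.pi * Complex.I) by ring,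
    Complex.exp_add, Complex.exp_int_mul_two_pi_mul_I, Complex.exp_add]
  ring

theorem integral_exp_int (n : ℤ) :
    ∫ t in (0 : ℝ)..1, Complex.exp (2 * Real.pi * Complex.I * n * t) = if n = 0 then 1 else 0 := by
  split_ifs with h
  · simp [h]
  · rw [integral_exp_mul_complex (by simp [h, Real.pi_ne_zero])]
    have := Complex.exp_int_mul_two_pi_mul_I n
    simp only [Complex.ofReal_one, mul_one, Complex.ofReal_zero, mul_zero, Complex.exp_zero]
    rw [mul_comm, this, sub_self, zero_div]

/-- Integrating against a character over one turn of the unit circle isolates each coefficient. -/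
theorem eq_zero_of_laurentExp_eq_zero (ha : IsEntireLaurent a) {b : ℂ}
    (h : ∀ t, laurentExp b a t = 0) : a = 0 := by
  funext k
  have hs : Summable fun j => ‖a j‖ := by simpa using ha 1 one_pos
  set f : ℤ → ℝ → ℂ := fun j t => a j * Complex.exp (2 * Real.pi * Complex.I * (j - k : ℤ) * t)
  have hc : ∀ j, Continuous (f j) := fun j => by fun_prop
  have hn : ∀ j t, ‖f j t‖ = ‖a j‖ := by
    intro j t
    rw [norm_mul, show 2 * Real.pi * Complex.I * (j - k : ℤ) * t =
      ((2 * Real.pi * (j - k : ℤ) * t : ℝ) : ℂ) * Complex.I by push_cast; ring,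
      Complex.norm_exp_ofReal_mul_I, mul_one]
  have h1 := MeasureTheory.hasSum_integral_of_summable_integral_norm
    (μ := MeasureTheory.volume.restrict (Set.Ioc (0 : ℝ) 1)) (F := f)
    (fun j => ((hc j).integrableOn_Icc).mono_set Set.Ioc_subset_Icc_self) (by simpa [hn] using hs)
  have h2 : ∀ t : ℝ, ∑' j, f j t = 0 := by
    intro t
    have h3 := (ha.hasSum b (2 * Real.pi * Complex.I * t)).mul_left
      (Complex.exp (-((b + k) * (2 * Real.pi * Complex.I * t))))
    rw [h, mul_zero] at h3
    refine (h3.congr_fun fun j => ?_).tsum_eq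
    rw [mul_left_comm, ← Complex.exp_add]
    simp only [f]
    congr 2
    push_cast
    ring
  simp only [h2, MeasureTheory.integral_zero] at h1
  have h4 : ∀ j, ∫ t in Set.Ioc (0 : ℝ) 1, f j t = if j = k then a j else 0 := by
    intro j
    rw [← intervalIntegral.integral_of_le zero_le_one]
    simp only [f]
    rw [intervalIntegral.integral_const_mul, integral_exp_int]
    simp [sub_eq_zero]
  simp only [h4] at h1
  have h5 := h1.unique (hasSum_ite_eq k (a k) |>.congr_fun fun j => by split_ifs with h <;> simp [h])
  exact h5.symm

end IsEntireLaurent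

/-- A Laurent series with Heun coefficients satisfies the Heun equation, written in the coordinate
`t = log z`. -/
theorem IsHeunCoeff.laurentExp_ode {l lam μ δ b : ℂ} {a : ℤ → ℂ} (ha : IsHeunCoeff l lam μ δ a)
    (hs : IsEntireLaurent a) (hb : b = -l / 2 - δ) (t : ℂ) :
    laurentExp b (fun k => (b + k) * ((b + k) * a k)) t +
      (l + μ * (Complex.exp (-t) - Complex.exp t)) * laurentExp b (fun k => (b + k) * a k) t +
      (lam - μ * (l + 1) * Complex.exp t) * laurentExp b a t = 0 := by
  have hs1 := hs.add_mul b
  have hs2 := hs1.add_mul b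
  have e1 := hs2.hasSum b t
  have e2 := (hs1.hasSum b t).mul_left l
  have e3 := (hs1.hasSum_shift b t 1).mul_left μ
  have e4 := (hs1.hasSum_shift b t (-1)).mul_left (-μ)
  have e5 := (hs.hasSum b t).mul_left lam
  have e6 := (hs.hasSum_shift b t (-1)).mul_left (-μ * (l + 1))
  have e := ((((e1.add e2).add e3).add e4).add e5).add e6
  have e0 := e.unique (hasSum_zero.congr_fun fun k => ?_)
  · push_cast at e0
    simp only [neg_neg, one_mul, neg_mul] at e0
    linear_combination e0
  · have := ha k
    subst hb
    push_cast
    rw [← sub_eq_add_neg k 1]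
    linear_combination Complex.exp ((-l / 2 - δ + k) * t) * this

/-! ### From coefficients to a monodromy eigenvector -/

/-- The branch of the logarithm near `z₁ = exp w`. -/
def logBranch (z₁ w z : ℂ) : ℂ := Complex.log (z / z₁) + w

theorem exp_logBranch {z₁ w z : ℂ} (hw : Complex.exp w = z₁) (hz : z ≠ 0) :
    Complex.exp (logBranch z₁ w z) = z := by
  have h1 : z₁ ≠ 0 := hw ▸ Complex.exp_ne_zero w
  rw [logBranch, Complex.exp_add, Complex.exp_log (div_ne_zero hz h1), hw, div_mul_cancel₀ _ h1]

theorem hasDerivAt_logBranch {z₁ w z : ℂ} (hz : z / z₁ ∈ Complex.slitPlane) :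
    HasDerivAt (logBranch z₁ w) z⁻¹ z := by
  have h0 : z / z₁ ≠ 0 := Complex.slitPlane_ne_zero hz
  have h1 : z₁ ≠ 0 := by rintro rfl; simp at h0
  have h2 : z ≠ 0 := by rintro rfl; simp at h0
  have h := (((hasDerivAt_id z).div_const z₁).clog hz).add_const w
  refine h.congr_deriv ?_
  simp only [id]
  field_simp

theorem eventually_div_mem_slitPlane {z₁ : ℂ} (h1 : z₁ ≠ 0) :
    ∀ᶠ z in 𝓝 z₁, z / z₁ ∈ Complex.slitPlane := by
  have h2 : Tendsto (fun z => z / z₁) (𝓝 z₁) (𝓝 1) := by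
    have : ContinuousAt (fun z : ℂ => z / z₁) z₁ := by fun_prop
    simpa [ContinuousAt, h1] using this
  exact h2.eventually (Complex.isOpen_slitPlane.mem_nhds Complex.one_mem_slitPlane)

theorem circuit_ne_zero {z₀ : ℂ} (hz : z₀ ≠ 0) (t : ℝ) : circuit z₀ t ≠ 0 :=
  mul_ne_zero hz (Complex.exp_ne_zero _)

theorem continuous_circuit (z₀ : ℂ) : Continuous (circuit z₀) := by
  unfold circuit
  fun_prop

/-- Neighbouring branches of the logarithm along the circuit agree. -/
theorem eventually_logBranch_eq {z₀ w : ℂ} (hz : z₀ ≠ 0) {t u : ℝ} (hut : |u - t| < 1 / 4) :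
    logBranch (circuit z₀ u) (w + 2 * Real.pi * Complex.I * u) =ᶠ[𝓝 (circuit z₀ u)]
      logBranch (circuit z₀ t) (w + 2 * Real.pi * Complex.I * t) := by
  have hu := circuit_ne_zero hz u
  have ht := circuit_ne_zero hz t
  have h2 : Tendsto (fun z => z / circuit z₀ u) (𝓝 (circuit z₀ u)) (𝓝 1) := by
    have : ContinuousAt (fun z : ℂ => z / circuit z₀ u) (circuit z₀ u) := by fun_prop
    simpa [ContinuousAt, hu] using this
  have h3 : ∀ᶠ z : ℂ in 𝓝 1, 0 < z.re :=
    (Complex.continuous_re.tendsto 1).eventually (lt_mem_nhds (by simp))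
  filter_upwards [h2.eventually h3] with z hre
  set q := z / circuit z₀ u with hq
  have hq0 : q ≠ 0 := by rintro h; simp [h] at hre
  have hrot : circuit z₀ u / circuit z₀ t =
      Complex.exp ((2 * Real.pi * (u - t) : ℝ) * Complex.I) := by
    rw [div_eq_iff ht, circuit, circuit, mul_left_comm, ← Complex.exp_add]
    congr 2
    push_cast
    ring
  -- Both arguments lie within `π/2` of `0`, so their sum stays in the principal range and `log` is
  -- additive.
  have hb : |2 * Real.pi * (u - t)| < Real.pi / 2 := by
    rw [abs_mul, abs_of_pos Real.two_pi_pos]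
    nlinarith [Real.pi_pos]
  obtain ⟨hb1, hb2⟩ := abs_lt.1 hb
  have hIoc : 2 * Real.pi * (u - t) ∈ Set.Ioc (-Real.pi) Real.pi :=
    ⟨by linarith [Real.pi_pos], by linarith [Real.pi_pos]⟩
  have harg : |q.arg| < Real.pi / 2 := Complex.abs_arg_lt_pi_div_two_iff.2 (Or.inl hre)
  obtain ⟨ha1, ha2⟩ := abs_lt.1 harg
  have hlog : Complex.log (Complex.exp ((2 * Real.pi * (u - t) : ℝ) * Complex.I)) =
      (2 * Real.pi * (u - t) : ℝ) * Complex.I :=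
    Complex.log_exp (by simpa using hIoc.1) (by simpa using hIoc.2)
  have key : Complex.log (z / circuit z₀ t) =
      Complex.log q + (2 * Real.pi * (u - t) : ℝ) * Complex.I := by
    rw [← hlog, ← (Complex.log_mul_eq_add_log_iff hq0 (Complex.exp_ne_zero _)).2, ← hrot, hq,
      div_mul_div_cancel₀ hu]
    rw [Complex.arg_exp_mul_I, (toIocMod_eq_self Real.two_pi_pos).2
      (by rwa [show -Real.pi + 2 * Real.pi = Real.pi by ring])]
    exact ⟨by linarith, by linarith⟩
  rw [logBranch, logBranch, key]
  push_cast
  ring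

theorem laurentExp_heun_germ {l lam μ δ b z₁ w : ℂ} {a : ℤ → ℂ} (ha : IsHeunCoeff l lam μ δ a)
    (hs : IsEntireLaurent a) (hb : b = -l / 2 - δ) (hw : Complex.exp w = z₁) :
    ∀ᶠ z in 𝓝 z₁, heunOperator (l + 1) lam μ (fun z => laurentExp b a (logBranch z₁ w z)) z = 0 := by
  have h1 : z₁ ≠ 0 := hw ▸ Complex.exp_ne_zero w
  have hs1 := hs.add_mul b
  have hd : ∀ a', IsEntireLaurent a' → ∀ z, z / z₁ ∈ Complex.slitPlane →
      HasDerivAt (fun z => laurentExp b a' (logBranch z₁ w z))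
        (laurentExp b (fun k => (b + k) * a' k) (logBranch z₁ w z) * z⁻¹) z := fun a' ha' z hz =>
    (ha'.hasDerivAt b _).comp z (hasDerivAt_logBranch hz)
  have hev := eventually_div_mem_slitPlane h1
  filter_upwards [hev, hev.eventually_nhds, eventually_ne_nhds h1] with z hz hz' hz0
  have hd1 : deriv (fun z => laurentExp b a (logBranch z₁ w z)) =ᶠ[𝓝 z]
      fun z => laurentExp b (fun k => (b + k) * a k) (logBranch z₁ w z) * z⁻¹ := by
    filter_upwards [hz'] with y hy
    exact (hd a hs y hy).deriv
  have hd2 := ((hd _ hs1 z hz).mul (hasDerivAt_inv hz0)).deriv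
  have hode := ha.laurentExp_ode hs hb (logBranch z₁ w z)
  rw [Complex.exp_neg, exp_logBranch hw hz0] at hode
  rw [heunOperator, hd1.deriv_eq, hd1.eq_of_nhds]
  erw [hd2]
  field_simp
  field_simp at hode
  linear_combination hode

/-- The continuation shifts the branch of the logarithm by `2πi t`; a full turn multiplies the
series by `exp (2πi b)`. -/
theorem IsHeunCoeff.isHeunMonodromyEigenvalue {l lam μ δ b z₀ : ℂ} {a : ℤ → ℂ}
    (ha : IsHeunCoeff l lam μ δ a) (ha0 : a ≠ 0) (hs : IsEntireLaurent a) (hb : b = -l / 2 - δ)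
    (hz : z₀ ≠ 0) :
    IsHeunMonodromyEigenvalue (l + 1) lam μ z₀ (Complex.exp (2 * Real.pi * Complex.I * b)) := by
  set w := Complex.log z₀ with hw
  have hexp : ∀ t : ℝ, Complex.exp (w + 2 * Real.pi * Complex.I * t) = circuit z₀ t := fun t => by
    rw [Complex.exp_add, hw, Complex.exp_log hz, circuit]
  have han : ∀ z₁ w', z₁ ≠ 0 →
      AnalyticAt ℂ (fun z => laurentExp b a (logBranch z₁ w' z)) z₁ := by
    intro z₁ w' h1
    rw [Complex.analyticAt_iff_eventually_differentiableAt]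
    filter_upwards [eventually_div_mem_slitPlane h1] with z hz
    exact ((hs.hasDerivAt b _).comp z (hasDerivAt_logBranch hz)).differentiableAt
  have hc0 : circuit z₀ 0 = z₀ := by simp [circuit]
  have hc1 : circuit z₀ 1 = z₀ := by simp [circuit]
  refine ⟨fun z => laurentExp b a (logBranch z₀ w z), ⟨han _ _ hz, laurentExp_heun_germ ha hs hb
    (Complex.exp_log hz)⟩, fun h => ?_, fun t z => laurentExp b a
    (logBranch (circuit z₀ t) (w + 2 * Real.pi * Complex.I * t) z),
    fun t _ => han _ _ (circuit_ne_zero hz t), fun t _ => ?_, ?_, ?_⟩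
  -- A zero germ at `z₀` pulls back through `exp` to a zero germ of the entire function `laurentExp
  -- b a`.
  · refine ha0 (IsEntireLaurent.eq_zero_of_laurentExp_eq_zero hs (b := b) fun t => ?_)
    have hdiff : Differentiable ℂ (laurentExp b a) := fun t => (hs.hasDerivAt b t).differentiableAt
    have hnear : laurentExp b a =ᶠ[𝓝 w] 0 := by
      have h1 : Tendsto Complex.exp (𝓝 w) (𝓝 z₀) := by
        have := Complex.continuous_exp.tendsto w
        rwa [hw, Complex.exp_log hz] at this
      have h2 : ∀ᶠ v in 𝓝 w, ‖v - w‖ < Real.pi := by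
        have := Metric.ball_mem_nhds w Real.pi_pos
        filter_upwards [this] with v hv
        rwa [mem_ball_iff_norm] at hv
      filter_upwards [h1.eventually h, h2] with v hv hv2
      have him := (Complex.abs_im_le_norm (v - w)).trans_lt hv2
      obtain ⟨h3, h4⟩ := abs_lt.1 him
      have h5 : logBranch z₀ w (Complex.exp v) = v := by
        rw [logBranch, show Complex.exp v / z₀ = Complex.exp (v - w) by
          rw [Complex.exp_sub, hw, Complex.exp_log hz], Complex.log_exp h3 h4.le]
        ring
      simpa [h5] using hv
    have han' : AnalyticOnNhd ℂ (laurentExp b a) Set.univ := fun t _ => hdiff.analyticAt t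
    exact congrFun (han'.eq_of_eventuallyEq (fun t _ => analyticAt_const) hnear) t
  · refine mem_nhdsWithin_of_mem_nhds ?_
    filter_upwards [Metric.ball_mem_nhds t (show (0 : ℝ) < 1 / 4 by norm_num)] with u hu
    rw [Metric.mem_ball, Real.dist_eq] at hu
    filter_upwards [eventually_logBranch_eq (w := w) hz hu] with z hz
    rw [hz]
  · simp only [hc0, Complex.ofReal_zero, mul_zero, add_zero]
    exact EventuallyEq.rfl
  · refine Eventually.of_forall fun z => ?_
    simp only [hc1, Complex.ofReal_one, mul_one]
    rw [← IsEntireLaurent.laurentExp_add_two_pi_I]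
    simp only [logBranch]
    ring_nf

/-! ### Analytic extension along a path -/

/-- A family of germs along the path `γ`, each the analytic extension of its neighbours. -/
structure IsGermFamily (γ : ℝ → ℂ) (F : ℝ → ℂ → ℂ) : Prop where
  analyticAt : ∀ t ∈ Set.Icc (0 : ℝ) 1, AnalyticAt ℂ (F t) (γ t)
  eventuallyEq : ∀ t ∈ Set.Icc (0 : ℝ) 1, ∀ᶠ u in 𝓝[Set.Icc (0 : ℝ) 1] t, F u =ᶠ[𝓝 (γ u)] F t

theorem AnalyticAt.heunOperator {n lam μ z : ℂ} {E : ℂ → ℂ} (h : AnalyticAt ℂ E z) :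
    AnalyticAt ℂ (heunOperator n lam μ E) z := by
  have h1 := h.deriv
  have h2 := h1.deriv
  unfold _root_.heunOperator
  fun_prop

theorem Filter.EventuallyEq.heunOperator {n lam μ z : ℂ} {E G : ℂ → ℂ} (h : E =ᶠ[𝓝 z] G) :
    heunOperator n lam μ E =ᶠ[𝓝 z] heunOperator n lam μ G := by
  filter_upwards [h, h.deriv, h.deriv.deriv] with y h0 h1 h2
  rw [_root_.heunOperator, _root_.heunOperator, h0, h1, h2]

namespace IsGermFamily

variable {γ : ℝ → ℂ} {F : ℝ → ℂ → ℂ}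

theorem deriv (h : IsGermFamily γ F) : IsGermFamily γ fun t => deriv (F t) where
  analyticAt t ht := (h.analyticAt t ht).deriv
  eventuallyEq t ht := (h.eventuallyEq t ht).mono fun _ hu => EventuallyEq.deriv hu

theorem heunOperator (h : IsGermFamily γ F) (n lam μ : ℂ) :
    IsGermFamily γ fun t => heunOperator n lam μ (F t) where
  analyticAt t ht := (h.analyticAt t ht).heunOperator
  eventuallyEq t ht := (h.eventuallyEq t ht).mono fun _ hu => hu.heunOperator

/-- The identity theorem for analytic extension along a path. -/
theorem eventuallyEq_zero (h : IsGermFamily γ F) (hγ : Continuous γ) (h0 : F 0 =ᶠ[𝓝 (γ 0)] 0)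
    {t : ℝ} (ht : t ∈ Set.Icc (0 : ℝ) 1) : F t =ᶠ[𝓝 (γ t)] 0 := by
  refine (isPreconnected_Icc.induction₂' (fun t u => F t =ᶠ[𝓝 (γ t)] 0 ↔ F u =ᶠ[𝓝 (γ u)] 0)
    (fun t ht => ?_) (fun x y z _ _ _ hxy hyz => hxy.trans hyz)
    (Set.left_mem_Icc.2 zero_le_one) ht).1 h0
  have hlim : Tendsto γ (𝓝[Set.Icc (0 : ℝ) 1] t) (𝓝 (γ t)) :=
    (hγ.tendsto t).mono_left nhdsWithin_le_nhds
  rcases (h.analyticAt t ht).eventually_eq_zero_or_eventually_ne_zero with hz | hz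
  · filter_upwards [h.eventuallyEq t ht, hlim.eventually hz.eventually_nhds] with u hu hu'
    have : F u =ᶠ[𝓝 (γ u)] 0 := hu.trans hu'
    exact ⟨⟨fun _ => this, fun _ => hz⟩, ⟨fun _ => hz, fun _ => this⟩⟩
  -- Isolated zeros make nonvanishing of the germ locally constant along the path, just as vanishing
  -- is.
  · have hne : ∀ (y : ℂ), (∀ᶠ z in 𝓝 y, z ≠ γ t → F t z ≠ 0) → ¬ (F t =ᶠ[𝓝 y] 0) := by
      intro y hy h0
      have h1 : ∀ᶠ z in 𝓝 y, z = γ t := by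
        filter_upwards [hy, h0] with z hz hz0
        by_contra hzt
        exact hz hzt hz0
      have hy' : y = γ t := h1.self_of_nhds
      subst hy'
      obtain ⟨z, hz, hz'⟩ :=
        ((h1.filter_mono (nhdsWithin_le_nhds (s := {γ t}ᶜ))).and self_mem_nhdsWithin).exists
      exact hz' hz
    have hz' := eventually_nhdsWithin_iff.1 hz
    filter_upwards [h.eventuallyEq t ht, hlim.eventually hz'.eventually_nhds] with u hu hu'
    have h1 := hne _ hz'
    have h2 : ¬ (F u =ᶠ[𝓝 (γ u)] 0) := fun h => hne _ hu' (hu.symm.trans h)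
    exact ⟨⟨fun h => absurd h h1, fun h => absurd h h2⟩, ⟨fun h => absurd h h2, fun h => absurd h h1⟩⟩

theorem hasDerivWithinAt (h : IsGermFamily γ F) {t : ℝ} (ht : t ∈ Set.Icc (0 : ℝ) 1) {γ' : ℂ}
    (hγ : HasDerivAt γ γ' t) :
    HasDerivWithinAt (fun t => F t (γ t)) (_root_.deriv (F t) (γ t) * γ') (Set.Icc 0 1) t := by
  have h1 := (h.analyticAt t ht).differentiableAt.hasDerivAt.comp t hγ
  refine h1.hasDerivWithinAt.congr_of_eventuallyEq ?_ rfl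
  filter_upwards [h.eventuallyEq t ht] with u hu
  exact hu.eq_of_nhds

end IsGermFamily

theorem hasDerivAt_circuit (z₀ : ℂ) (t : ℝ) :
    HasDerivAt (circuit z₀) (2 * Real.pi * Complex.I * circuit z₀ t) t := by
  have h1 : HasDerivAt (fun t : ℝ => 2 * (Real.pi : ℂ) * Complex.I * (t : ℂ))
      (2 * Real.pi * Complex.I) t := by
    simpa using (Complex.ofRealCLM.hasDerivAt (x := t)).const_mul (2 * (Real.pi : ℂ) * Complex.I)
  refine (h1.cexp.const_mul z₀).congr_deriv ?_
  rw [circuit]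
  ring

/-! ### From a monodromy eigenvector to coefficients -/

/-- The character `t ↦ exp (-2 π i (b + k) t)`. -/
def twistedChar (b : ℂ) (k : ℤ) (t : ℝ) : ℂ :=
  Complex.exp (-(2 * Real.pi * Complex.I * (b + k) * t))

/-- The Fourier coefficients of a function with multiplier `exp (2 π i b)`. -/
def twistedCoeff (b : ℂ) (g : ℝ → ℂ) (k : ℤ) : ℂ := ∫ t in (0 : ℝ)..1, g t * twistedChar b k t

theorem continuous_twistedChar (b : ℂ) (k : ℤ) : Continuous (twistedChar b k) := by
  unfold twistedChar
  fun_prop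

theorem circuit_mul_twistedChar (b z₀ : ℂ) (k : ℤ) (t : ℝ) :
    circuit z₀ t * twistedChar b k t = z₀ * twistedChar b (k - 1) t := by
  rw [circuit, twistedChar, twistedChar, mul_assoc, ← Complex.exp_add]
  congr 2
  push_cast
  ring

theorem intervalIntegrable_mul_twistedChar {g : ℝ → ℂ} (hg : ContinuousOn g (Set.Icc 0 1)) (b : ℂ)
    (k : ℤ) :
    IntervalIntegrable (fun t => g t * twistedChar b k t) MeasureTheory.volume 0 1 := by
  refine ContinuousOn.intervalIntegrable ?_
  rw [Set.uIcc_of_le zero_le_one]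
  exact hg.mul (continuous_twistedChar b k).continuousOn

/-- Integration by parts. -/
theorem twistedCoeff_of_hasDerivWithinAt {b : ℂ} {g h : ℝ → ℂ}
    (hg : ∀ t ∈ Set.Icc (0 : ℝ) 1,
      HasDerivWithinAt g (2 * Real.pi * Complex.I * h t) (Set.Icc 0 1) t)
    (hh : ContinuousOn h (Set.Icc 0 1)) (h1 : g 1 = Complex.exp (2 * Real.pi * Complex.I * b) * g 0)
    (k : ℤ) : twistedCoeff b h k = (b + k) * twistedCoeff b g k := by
  have hgc : ContinuousOn g (Set.Icc 0 1) := fun t ht => (hg t ht).continuousWithinAt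
  have hχ : ∀ t : ℝ, HasDerivAt (twistedChar b k)
      (-(2 * Real.pi * Complex.I * (b + k)) * twistedChar b k t) t := by
    intro t
    have h2 : HasDerivAt (fun t : ℝ => -(2 * (Real.pi : ℂ) * Complex.I * (b + k) * (t : ℂ)))
        (-(2 * Real.pi * Complex.I * (b + k))) t := by
      simpa using
        (Complex.ofRealCLM.hasDerivAt (x := t)).const_mul (-(2 * (Real.pi : ℂ) * Complex.I * (b + k)))
    refine h2.cexp.congr_deriv ?_
    rw [twistedChar]
    ring
  have hI1 := intervalIntegrable_mul_twistedChar hh b k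
  have hI2 := intervalIntegrable_mul_twistedChar hgc b k
  have hF := intervalIntegral.integral_eq_sub_of_hasDerivAt_of_le (a := 0) (b := 1)
    (f := fun t => g t * twistedChar b k t)
    (f' := fun t => 2 * Real.pi * Complex.I * (h t * twistedChar b k t) -
      2 * Real.pi * Complex.I * (b + k) * (g t * twistedChar b k t)) zero_le_one
    (hgc.mul (continuous_twistedChar b k).continuousOn) (fun t ht => by
      have h2 := ((hg t (Set.Ioo_subset_Icc_self ht)).hasDerivAt
        (Icc_mem_nhds ht.1 ht.2)).mul (hχ t)
      refine h2.congr_deriv ?_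
      ring) ((hI1.const_mul _).sub (hI2.const_mul _))
  rw [intervalIntegral.integral_sub (hI1.const_mul _) (hI2.const_mul _),
    intervalIntegral.integral_const_mul, intervalIntegral.integral_const_mul] at hF
  -- The multiplier of `g` cancels that of the character, so there is no boundary term.
  have hbd : g 1 * twistedChar b k 1 - g 0 * twistedChar b k 0 = 0 := by
    have h2 : twistedChar b k 1 = Complex.exp (-(2 * Real.pi * Complex.I * b)) := by
      rw [twistedChar, show -(2 * Real.pi * Complex.I * (b + k) * (1 : ℝ)) =
        -(2 * Real.pi * Complex.I * b) + (-k : ℤ) * (2 * Real.pi * Complex.I) by push_cast; ring,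
        Complex.exp_add, Complex.exp_int_mul_two_pi_mul_I, mul_one]
    rw [h1, h2, Complex.exp_neg, twistedChar]
    have := Complex.exp_ne_zero (2 * Real.pi * Complex.I * b)
    simp only [Complex.ofReal_zero, mul_zero, neg_zero, Complex.exp_zero]
    field_simp
    ring
  rw [hbd] at hF
  refine mul_left_cancel₀ Complex.two_pi_I_ne_zero ?_
  rw [twistedCoeff, twistedCoeff]
  linear_combination hF

theorem exists_norm_twistedCoeff_le {g : ℝ → ℂ} (hg : ContinuousOn g (Set.Icc 0 1)) (b : ℂ) :
    ∃ C, ∀ k, ‖twistedCoeff b g k‖ ≤ C := by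
  obtain ⟨C, hC⟩ := isCompact_Icc.exists_bound_of_continuousOn
    (f := fun t => g t * twistedChar b 0 t)
    (hg.mul (continuous_twistedChar b 0).continuousOn)
  refine ⟨C, fun k => ?_⟩
  have h1 := intervalIntegral.norm_integral_le_of_norm_le_const (a := 0) (b := 1)
    (f := fun t => g t * twistedChar b k t) (C := C) fun t ht => ?_
  · rw [twistedCoeff]
    simpa using h1
  · rw [Set.uIoc_of_le zero_le_one] at ht
    refine le_of_eq_of_le ?_ (hC t (Set.Ioc_subset_Icc_self ht))
    rw [norm_mul, norm_mul, twistedChar, twistedChar, Complex.norm_exp, Complex.norm_exp]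
    simp

/-- After multiplication by `twistedChar b 0` these are ordinary Fourier coefficients, and Parseval
applies. -/
theorem eqOn_zero_of_twistedCoeff_eq_zero {g : ℝ → ℂ} (hg : ContinuousOn g (Set.Icc 0 1)) {b : ℂ}
    (h : ∀ k, twistedCoeff b g k = 0) : Set.EqOn g 0 (Set.Ioc 0 1) := by
  set f : ℝ → ℂ := fun t => g t * twistedChar b 0 t with hf
  have hfc : ContinuousOn f (Set.Icc 0 1) := hg.mul (continuous_twistedChar b 0).continuousOn
  have hmem : MeasureTheory.MemLp f 2 (MeasureTheory.volume.restrict (Set.Ioc (0 : ℝ) 1)) := by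
    obtain ⟨C, hC⟩ := isCompact_Icc.exists_bound_of_continuousOn hfc
    refine MeasureTheory.MemLp.of_bound
      ((hfc.mono Set.Ioc_subset_Icc_self).aestronglyMeasurable measurableSet_Ioc) C ?_
    filter_upwards [MeasureTheory.ae_restrict_mem measurableSet_Ioc] with t ht
    exact hC t (Set.Ioc_subset_Icc_self ht)
  have hpars := hasSum_sq_fourierCoeffOn zero_lt_one hmem
  have hcoeff : ∀ k, fourierCoeffOn zero_lt_one f k = 0 := by
    intro k
    rw [fourierCoeffOn_eq_integral, sub_zero, div_one, one_smul, ← h k, twistedCoeff]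
    refine intervalIntegral.integral_congr fun t _ => ?_
    simp only [hf]
    rw [fourier_coe_apply, smul_eq_mul, mul_left_comm, twistedChar, twistedChar, ← Complex.exp_add]
    congr 2
    push_cast
    ring
  simp only [hcoeff, norm_zero, ne_eq, OfNat.ofNat_ne_zero, not_false_eq_true, zero_pow] at hpars
  have hint := hpars.unique hasSum_zero
  simp only [sub_zero, inv_one, one_smul] at hint
  have hnc : ContinuousOn (fun t => ‖f t‖ ^ 2) (Set.Icc 0 1) := hfc.norm.pow 2
  rw [intervalIntegral.integral_eq_zero_iff_of_le_of_nonneg_ae zero_le_one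
    (Eventually.of_forall fun t => by positivity)
    (ContinuousOn.intervalIntegrable (by rwa [Set.uIcc_of_le zero_le_one]))] at hint
  have heq := MeasureTheory.Measure.eqOn_Ioc_of_ae_eq _ hint (hnc.mono Set.Ioc_subset_Icc_self)
    continuousOn_const
  intro t ht
  have h1 := heq ht
  simpa [hf, twistedChar] using h1

/-- The coefficients are Fourier coefficients along the single circle through `z₀`, divided by
`z₀^k`. This gives only the bound `C ‖z₀‖^{-k}`, which the uniqueness of the recessive solution can
already use. -/
theorem exists_heunCoeff_of_isHeunMonodromyEigenvalue {l lam μ δ b z₀ : ℂ} (hz : z₀ ≠ 0)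
    (hb : b = -l / 2 - δ)
    (h : IsHeunMonodromyEigenvalue (l + 1) lam μ z₀ (Complex.exp (2 * Real.pi * Complex.I * b))) :
    ∃ a : ℤ → ℂ, a ≠ 0 ∧ IsHeunCoeff l lam μ δ a ∧
      ∃ C ρ : ℝ, 0 < ρ ∧ ∀ k : ℤ, ‖a k‖ ≤ C * ρ ^ k := by
  obtain ⟨E, ⟨hEan, hEsol⟩, hE0, F, hFan, hFloc, hF0, hF1⟩ := h
  have hc0 : circuit z₀ 0 = z₀ := by simp [circuit]
  have hc1 : circuit z₀ 1 = z₀ := by simp [circuit]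
  rw [hc0] at hF0
  rw [hc1] at hF1
  have hfam : IsGermFamily (circuit z₀) F := ⟨hFan, hFloc⟩
  have hode : ∀ t ∈ Set.Icc (0 : ℝ) 1, heunOperator (l + 1) lam μ (F t) (circuit z₀ t) = 0 :=
    fun t ht => ((hfam.heunOperator (l + 1) lam μ).eventuallyEq_zero (continuous_circuit z₀)
      (by rw [hc0]; exact hF0.heunOperator.trans hEsol) ht).eq_of_nhds
  have hF01 : F 1 =ᶠ[𝓝 z₀] fun z => Complex.exp (2 * Real.pi * Complex.I * b) * F 0 z := by
    filter_upwards [hF0, hF1] with z h0 h1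
    rw [h1, h0]
  set γ := circuit z₀ with hγ
  set G0 : ℝ → ℂ := fun t => F t (γ t) with hG0
  set P1 : ℝ → ℂ := fun t => deriv (F t) (γ t) with hP1
  set P2 : ℝ → ℂ := fun t => deriv (deriv (F t)) (γ t) with hP2
  have hd0 : ∀ t ∈ Set.Icc (0 : ℝ) 1,
      HasDerivWithinAt G0 (2 * Real.pi * Complex.I * (γ t * P1 t)) (Set.Icc 0 1) t := fun t ht =>
    (hfam.hasDerivWithinAt ht (hasDerivAt_circuit z₀ t)).congr_deriv (by ring)
  have hdP : ∀ t ∈ Set.Icc (0 : ℝ) 1,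
      HasDerivWithinAt P1 (2 * Real.pi * Complex.I * (γ t * P2 t)) (Set.Icc 0 1) t := fun t ht =>
    (hfam.deriv.hasDerivWithinAt ht (hasDerivAt_circuit z₀ t)).congr_deriv (by ring)
  have hd1 : ∀ t ∈ Set.Icc (0 : ℝ) 1, HasDerivWithinAt (fun t => γ t * P1 t)
      (2 * Real.pi * Complex.I * (γ t * P1 t + γ t ^ 2 * P2 t)) (Set.Icc 0 1) t := fun t ht =>
    ((hasDerivAt_circuit z₀ t).hasDerivWithinAt.mul (hdP t ht)).congr_deriv (by ring)
  have hγc : ContinuousOn γ (Set.Icc 0 1) := (continuous_circuit z₀).continuousOn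
  have hG0c : ContinuousOn G0 (Set.Icc 0 1) := fun t ht => (hd0 t ht).continuousWithinAt
  have hP1c : ContinuousOn P1 (Set.Icc 0 1) := fun t ht => (hdP t ht).continuousWithinAt
  have hP2c : ContinuousOn P2 (Set.Icc 0 1) := fun t ht =>
    (hfam.deriv.deriv.hasDerivWithinAt ht (hasDerivAt_circuit z₀ t)).continuousWithinAt
  have hG1c : ContinuousOn (fun t => γ t * P1 t) (Set.Icc 0 1) := hγc.mul hP1c
  have hb0 : G0 1 = Complex.exp (2 * Real.pi * Complex.I * b) * G0 0 := by
    simp only [hG0]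
    rw [hc0, hc1]
    exact hF01.eq_of_nhds
  have hb1 : γ 1 * P1 1 = Complex.exp (2 * Real.pi * Complex.I * b) * (γ 0 * P1 0) := by
    simp only [hP1]
    rw [hc0, hc1, hF01.deriv.eq_of_nhds, deriv_const_mul_field]
    ring
  have hA1 : ∀ k : ℤ, twistedCoeff b (fun t => γ t * P1 t) k = (b + k) * twistedCoeff b G0 k :=
    twistedCoeff_of_hasDerivWithinAt hd0 hG1c hb0
  have hA2 := twistedCoeff_of_hasDerivWithinAt hd1
    (hG1c.add ((hγc.pow 2).mul hP2c)) hb1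
  have hrec : ∀ k : ℤ, ((b + k) ^ 2 + l * (b + k) + lam) * twistedCoeff b G0 k +
      μ * z₀⁻¹ * (b + k + 1) * twistedCoeff b G0 (k + 1) -
      μ * z₀ * (b + k + l) * twistedCoeff b G0 (k - 1) = 0 := by
    intro k
    have i0 := fun k => intervalIntegrable_mul_twistedChar hG0c b k
    have i1 := fun k => intervalIntegrable_mul_twistedChar hG1c b k
    -- The equation solved for `(z d/dz)² E = zE' + z²E''`; multiplication by `z^{±1}` shifts the
    -- character index.
    have hpt : twistedCoeff b (fun t => γ t * P1 t + γ t ^ 2 * P2 t) k =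
        ∫ t in (0 : ℝ)..1, ((-l * (γ t * P1 t * twistedChar b k t) +
          (-μ * z₀⁻¹) * (γ t * P1 t * twistedChar b (k + 1) t)) +
          μ * z₀ * (γ t * P1 t * twistedChar b (k - 1) t)) +
          (-lam * (G0 t * twistedChar b k t) +
          μ * (l + 1) * z₀ * (G0 t * twistedChar b (k - 1) t)) := by
      rw [twistedCoeff]
      refine intervalIntegral.integral_congr fun t ht => ?_
      rw [Set.uIcc_of_le zero_le_one] at ht
      have e1 := hode t ht
      have e2 := circuit_mul_twistedChar b z₀ k t
      have e3 := circuit_mul_twistedChar b z₀ (k + 1) t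
      rw [add_sub_cancel_right] at e3
      have e4 : twistedChar b k t * z₀⁻¹ * z₀ = twistedChar b k t := by field_simp
      rw [heunOperator] at e1
      simp only [hG0, hP1, hP2]
      rw [← hγ] at e2 e3
      linear_combination twistedChar b k t * e1 +
        μ * z₀⁻¹ * deriv (F t) (γ t) * e3 + μ * deriv (F t) (γ t) * e4 +
        (μ * γ t * deriv (F t) (γ t) + μ * (l + 1) * F t (γ t)) * e2
    have q1 := (i1 k).const_mul (-l)
    have q2 := (i1 (k + 1)).const_mul (-μ * z₀⁻¹)
    have q3 := (i1 (k - 1)).const_mul (μ * z₀)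
    have q4 := (i0 k).const_mul (-lam)
    have q5 := (i0 (k - 1)).const_mul (μ * (l + 1) * z₀)
    rw [hA2, hA1, intervalIntegral.integral_add ((q1.add q2).add q3) (q4.add q5),
      intervalIntegral.integral_add (q1.add q2) q3, intervalIntegral.integral_add q1 q2,
      intervalIntegral.integral_add q4 q5] at hpt
    simp only [intervalIntegral.integral_const_mul] at hpt
    have e0 := hA1 k
    have e1 := hA1 (k + 1)
    have e2 := hA1 (k - 1)
    simp only [twistedCoeff] at hpt e0 e1 e2 ⊢
    rw [e0, e1, e2] at hpt
    push_cast at hpt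
    linear_combination hpt
  refine ⟨fun k => twistedCoeff b G0 k * z₀ ^ (-k), fun h0 => ?_, fun k => ?_, ?_⟩
  · have hzero := eqOn_zero_of_twistedCoeff_eq_zero hG0c (b := b) fun k => by
      exact (mul_eq_zero.1 (congrFun h0 k)).resolve_right (zpow_ne_zero _ hz)
    have hFan0 : AnalyticAt ℂ (F 0) z₀ := by
      have := hFan 0 (by simp)
      rwa [hc0] at this
    rcases hFan0.eventually_eq_zero_or_eventually_ne_zero with h1 | h1
    · exact hE0 (hF0.symm.trans h1)
    · have hlim : Tendsto γ (𝓝[Set.Icc (0 : ℝ) 1] 0) (𝓝 z₀) := by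
        have : Tendsto γ (𝓝 0) (𝓝 (γ 0)) := (continuous_circuit z₀).tendsto 0
        rw [hc0] at this
        exact this.mono_left nhdsWithin_le_nhds
      have h2 := hFloc 0 (by simp)
      have h3 := hlim.eventually (eventually_nhdsWithin_iff.1 h1)
      -- Points of the circuit with small `u > 0` differ from `z₀` and are zeros of `F 0`, against
      -- isolation of zeros.
      have h4 : ∀ᶠ u in 𝓝[Set.Ioo (0 : ℝ) 1] 0, False := by
        have hsub : 𝓝[Set.Ioo (0 : ℝ) 1] 0 ≤ 𝓝[Set.Icc (0 : ℝ) 1] 0 :=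
          nhdsWithin_mono _ Set.Ioo_subset_Icc_self
        filter_upwards [hsub h2, hsub h3, self_mem_nhdsWithin] with u hu2 hu3 hu
        refine hu3 ?_ (hu2.eq_of_nhds.symm.trans (hzero (Set.Ioo_subset_Ioc_self hu)))
        intro h5
        have h6 : Complex.exp (2 * Real.pi * Complex.I * u) = 1 := by
          have h7 : z₀ * Complex.exp (2 * Real.pi * Complex.I * u) = z₀ * 1 := by
            rw [mul_one]
            exact h5
          exact mul_left_cancel₀ hz h7
        obtain ⟨n, hn⟩ := Complex.exp_eq_one_iff.1 h6
        have h8 : (u : ℂ) = n := by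
          refine mul_left_cancel₀ Complex.two_pi_I_ne_zero ?_
          linear_combination hn
        have h9 : u = n := by exact_mod_cast h8
        have h10 : (0 : ℝ) < n ∧ (n : ℝ) < 1 := h9 ▸ hu
        have h11 : 0 < n := by exact_mod_cast h10.1
        have h12 : n < 1 := by exact_mod_cast h10.2
        omega
      have : (𝓝[Set.Ioo (0 : ℝ) 1] 0).NeBot := left_nhdsWithin_Ioo_neBot zero_lt_one
      exact h4.exists.elim fun _ h => h
  · have h1 := hrec k
    subst hb
    have e1 : z₀ ^ (-(k + 1)) = z₀ ^ (-k) * z₀⁻¹ := by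
      rw [neg_add, zpow_add₀ hz, zpow_neg_one]
    have e2 : z₀ ^ (-(k - 1)) = z₀ ^ (-k) * z₀ := by
      rw [neg_sub, sub_eq_neg_add, zpow_add₀ hz, zpow_one]
    beta_reduce
    rw [e1, e2]
    linear_combination z₀ ^ (-k) * h1
  · obtain ⟨C, hC⟩ := exists_norm_twistedCoeff_le hG0c b
    refine ⟨C, ‖z₀‖⁻¹, inv_pos.2 (norm_pos_iff.2 hz), fun k => ?_⟩
    rw [norm_mul, norm_zpow, inv_zpow, zpow_neg]
    gcongr
    exact hC k

/-! ### The eigenvalue criterion and its two cases -/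

/-- The monodromy eigenvalue criterion, with the exponents `k - δ - l / 2`, `2 δ = p ∈ ℤ`, and
`j` the central index of the reflection `k ↦ p - k` or `k ↦ p - 1 - k`. -/
theorem exists_infiniteProd_isHeunMonodromyEigenvalue_iff {l lam μ ω δ : ℂ} (hω : ω ≠ 0)
    (hμ : μ ≠ 0) (hparam : lam + μ ^ 2 = 1 / (4 * ω ^ 2)) {p j : ℤ} (hp : (p : ℂ) = 2 * δ)
    (hj : p - j = j ∨ p - j - 1 = j) (hm : ∀ k : ℤ, (k : ℂ) - δ - l / 2 ≠ 0) :
    ∃ R : ℤ → Matrix (Fin 2) (Fin 2) ℂ,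
      (∀ k, HasInfiniteProd (fun j => heunMatrix l lam μ ((j : ℂ) - δ)) k (R k)) ∧
      (∀ k : ℤ, R k = heunMatrix l lam μ ((k : ℂ) - δ) * R (k + 1)) ∧
      ∃ c : ℤ → ℂ, (∀ k, c k ≠ 0) ∧
        (∀ k : ℤ, c (k + 1) * ((k : ℂ) + 1 - δ - l / 2) = μ * c k) ∧
        ∀ z₀ : ℂ, z₀ ≠ 0 → (IsHeunMonodromyEigenvalue (l + 1) lam μ z₀
          (Complex.exp (2 * Real.pi * Complex.I * (-l / 2 - δ))) ↔
          ∃ ε : ℂ, ε ^ 2 = 1 ∧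
            heunInvolution l μ ω δ p (fun k => c k * R k 1 0) j = ε * (c j * R j 1 0)) := by
  have hp' : ∀ k : ℤ, (k : ℂ) - δ + l / 2 ≠ 0 := by
    intro k h
    refine hm (p - k) ?_
    push_cast
    linear_combination hp - h
  obtain ⟨R, hR, hRstep, hR1⟩ := exists_hasInfiniteProd_heunMatrix l lam μ δ
  obtain ⟨c, hc0, hc, hu, hu0, hus⟩ := exists_recessive_solution hμ hm hp' hRstep hR1
  refine ⟨R, hR, hRstep, c, hc0, hc, fun z₀ hz => ⟨fun h => ?_, ?_⟩⟩
  · obtain ⟨a, ha0, ha, C, ρ, hρ, hab⟩ := exists_heunCoeff_of_isHeunMonodromyEigenvalue hz rfl h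
    obtain ⟨ε, hε, hfix⟩ :=
      ha.exists_involution_eq hu hp hω hparam hμ hm hp' hu0 hus ha0 hρ hab
    exact ⟨ε, hε, hfix j⟩
  · rintro ⟨ε, hε, hfix⟩
    have hall := hu.involution_eq hp hω hμ hm hp' hparam hε hfix hj
    exact hu.isHeunMonodromyEigenvalue hu0
      (fun r hr => IsHeunCoeff.summable_of_involution_eq hε hall hus hr) rfl hz

end

theorem mainTheorem12 (l lam μ ω : ℂ) (hω : ω ≠ 0) (hμ : μ ≠ 0)
    (hparam : lam + μ ^ 2 = 1 / (4 * ω ^ 2)) :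
    ((∀ m : ℤ, l ≠ 2 * (m : ℂ)) →
      ∃ R : ℤ → Matrix (Fin 2) (Fin 2) ℂ,
        (∀ k : ℤ, HasInfiniteProd (fun j => heunMatrix l lam μ (j : ℂ)) k (R k)) ∧
        ∀ z₀ : ℂ, z₀ ≠ 0 →
          (IsHeunMonodromyEigenvalue (l + 1) lam μ z₀
              (Complex.exp (-((Real.pi : ℂ) * Complex.I * l))) ↔
            R 0 1 0 + ω * l * (R 0 1 0 - R 0 0 0) = 0 ∨
            R 0 1 0 - ω * l * (R 0 1 0 - R 0 0 0) = 0)) ∧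
    ((∀ m : ℤ, l ≠ 2 * (m : ℂ) + 1) →
      ∃ R : ℤ → Matrix (Fin 2) (Fin 2) ℂ,
        (∀ k : ℤ, HasInfiniteProd (fun j => heunMatrix l lam μ ((j : ℂ) - 1 / 2)) k (R k)) ∧
        ∀ z₀ : ℂ, z₀ ≠ 0 →
          (IsHeunMonodromyEigenvalue (l + 1) lam μ z₀
              (-Complex.exp (-((Real.pi : ℂ) * Complex.I * l))) ↔
            R 1 0 0 + 2 * ω * μ * (R 1 0 0 - R 1 1 0) = 0 ∨
            R 1 0 0 - 2 * ω * μ * (R 1 0 0 - R 1 1 0) = 0)) := by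
  have hR10 : ∀ {δ : ℂ} {R : ℤ → Matrix (Fin 2) (Fin 2) ℂ},
      (∀ k : ℤ, R k = heunMatrix l lam μ ((k : ℂ) - δ) * R (k + 1)) →
      ∀ k, R k 1 0 = R (k + 1) 0 0 := by
    intro δ R hR k
    rw [hR k, Matrix.mul_apply, Fin.sum_univ_two]
    simp [heunMatrix]
  have hsign : ∀ {x y q : ℂ}, q ≠ 0 →
      ((∃ ε : ℂ, ε ^ 2 = 1 ∧ q * -y = ε * (q * x)) ↔ x + y = 0 ∨ x - y = 0) := by
    intro x y q hq
    constructor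
    · rintro ⟨ε, hε, h⟩
      have h' : -y = ε * x := mul_left_cancel₀ hq (by linear_combination h)
      rcases mul_self_eq_one_iff.1 (by rw [← sq, hε] : ε * ε = 1) with rfl | rfl
      · left; linear_combination -h'
      · right; linear_combination h'
    · rintro (h | h)
      · exact ⟨1, by norm_num, by linear_combination -q * h⟩
      · exact ⟨-1, by norm_num, by linear_combination q * h⟩
  constructor
  · intro hl
    obtain ⟨R, hR, hRs, c, hc0, hc, hiff⟩ := exists_infiniteProd_isHeunMonodromyEigenvalue_iff
      (l := l) (δ := 0) (p := 0) (j := 0) hω hμ hparam (by simp) (by simp) fun k h =>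
        hl k (by linear_combination -2 * h)
    refine ⟨R, by simpa only [sub_zero] using hR, fun z₀ hz => ?_⟩
    -- The relation `c 0 * (-l/2) = μ * c (-1)` removes `c (-1)`, and `R (-1) 1 0 = R 0 0 0`.
    have h1 := hc (-1)
    have h2 := hR10 hRs (-1)
    rw [show (-1 : ℤ) + 1 = 0 by norm_num] at h1 h2
    push_cast at h1
    have key : heunInvolution l μ ω 0 0 (fun k => c k * R k 1 0) 0 =
        c 0 * -(ω * l * (R 0 1 0 - R 0 0 0)) := by
      rw [heunInvolution, show (0 : ℤ) - 0 = 0 by norm_num, show (0 : ℤ) - 1 = -1 by norm_num, h2]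
      push_cast
      linear_combination 2 * ω * R 0 0 0 * h1
    rw [show -((Real.pi : ℂ) * Complex.I * l) = 2 * Real.pi * Complex.I * (-l / 2 - 0) by ring,
      hiff z₀ hz, key, hsign (hc0 0)]
  · intro hl
    obtain ⟨R, hR, hRs, c, hc0, hc, hiff⟩ := exists_infiniteProd_isHeunMonodromyEigenvalue_iff
      -- Here `0` is central for `k ↦ p - 1 - k`, whereas with `δ = 0` it is central for `k ↦ p -
      -- k`.
      (l := l) (δ := 1 / 2) (p := 1) (j := 0) hω hμ hparam (by norm_num) (by norm_num) fun k h =>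
        hl (k - 1) (by push_cast; linear_combination -2 * h)
    refine ⟨R, hR, fun z₀ hz => ?_⟩
    have h1 := hc 0
    have h2 := hR10 hRs 0
    rw [zero_add] at h1 h2
    push_cast at h1
    have key : heunInvolution l μ ω (1 / 2) 1 (fun k => c k * R k 1 0) 0 =
        c 0 * -(2 * ω * μ * (R 1 0 0 - R 1 1 0)) := by
      rw [heunInvolution, show (1 : ℤ) - 0 = 1 by norm_num, show (1 : ℤ) - 1 = 0 by norm_num, h2]
      push_cast
      linear_combination 2 * ω * R 1 1 0 * h1
    have hexp : -Complex.exp (-((Real.pi : ℂ) * Complex.I * l)) =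
        Complex.exp (2 * Real.pi * Complex.I * (-l / 2 - 1 / 2)) := by
      rw [show 2 * Real.pi * Complex.I * (-l / 2 - 1 / 2) =
        -((Real.pi : ℂ) * Complex.I * l) - Real.pi * Complex.I by ring, Complex.exp_sub,
        Complex.exp_pi_mul_I, div_neg, div_one]
    rw [hexp, hiff z₀ hz, key, h2, hsign (hc0 0)]
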